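/- Let $n \ge 0$ be an integer and let $X_1,\dots,X_n$ be independent $\mathbb{Z}$-valued random variables on a probability space $(\Omega, \mathbb{P})$. For $\mathbb{Z}$-valued random variables $Z_1, Z_2$ put $$d_{\mathrm{TV}}(Z_1,Z_2) := \sup_{A \subseteq \mathbb{Z}} |\mathbb{P}(Z_1 \in A) - \mathbb{P}(Z_2 \in A)|.$$ Then $$d_{\mathrm{TV}}\Big(\sum_{j=1}^n X_j,\ 1 + \sum_{j=1}^n X_j\Big) \le \sqrt{\frac{2}{\pi}}\,\Big(\frac14 + \sum_{j=1}^n \big(1 - d_{\mathrm{TV}}(X_j, 1+X_j)\big)\Big)^{-1/2}.$$ This improves the bound $\big(\sum_{j=1}^n (1 - \max(\tfrac12, d_{\mathrm{TV}}(X_j,1+X_j)))\big)^{-1/2}$ of Barbour and Xia (1999): whenever $\sum_{j=1}^n (1 - \max(\tfrac12, d_{\mathrm{TV}}(X_j,1+X_j))) > 0$ (so that the latter bound is finite), the right-hand side above is strictly smaller than it. -/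

import Mathlib

open MeasureTheory ProbabilityTheory

/-- The total variation distance `sup_{A ⊆ ℤ} |P(Z₁ ∈ A) - P(Z₂ ∈ A)|` between the distributions
of two ℤ-valued random variables `Z₁`, `Z₂` on a probability space `(Ω, P)`. The terms of the
supremum all lie in `[0, 1]`, so it is a genuine supremum. -/
noncomputable def dTV {Ω : Type*} [MeasurableSpace Ω] (P : Measure Ω) (Z₁ Z₂ : Ω → ℤ) : ℝ :=
  ⨆ A : Set ℤ, |P.real {ω | Z₁ ω ∈ A} - P.real {ω | Z₂ ω ∈ A}|

/-- The mean of `f` under the Beta(1/2, 3/2) distribution on `[0, 1]`, written as a trigonometric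
integral. -/
noncomputable def betaMean (f : ℝ → ℝ) : ℝ :=
  (1 / Real.pi) * ∫ t in (0 : ℝ)..Real.pi, (1 + Real.cos t) * f ((1 - Real.cos t) / 2)

/-- The normalised central binomial coefficient `C(2n, n) / 4 ^ n`. -/
noncomputable def centralProb (n : ℕ) : ℝ :=
  ∏ i ∈ Finset.range n, (2 * (i : ℝ) + 1) / (2 * i + 2)

lemma centralProb_succ (n : ℕ) :
    centralProb (n + 1) = centralProb n * ((2 * (n : ℝ) + 1) / (2 * n + 2)) :=
  Finset.prod_range_succ _ _

lemma wallis_mul_centralProb_sq (n : ℕ) :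
    Real.Wallis.W n * ((2 * n + 1) * centralProb n ^ 2) = 1 := by
  induction n with
  | zero => simp [centralProb, Real.Wallis.W]
  | succ k ih =>
    rw [Real.Wallis.W_succ, centralProb_succ]
    have h : Real.Wallis.W k * ((2 * k + 2) / (2 * k + 1) * ((2 * k + 2) / (2 * k + 3))) *
        ((2 * ((k + 1 : ℕ) : ℝ) + 1) * (centralProb k * ((2 * (k : ℝ) + 1) / (2 * k + 2))) ^ 2)
        = Real.Wallis.W k * ((2 * k + 1) * centralProb k ^ 2) := by
      push_cast
      field_simp
      ring
    rw [h, ih]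

lemma centralProb_sq_mul_le (n : ℕ) : centralProb n ^ 2 * (n + 1 / 4) ≤ 1 / Real.pi := by
  have hmono : Monotone fun n : ℕ => centralProb n ^ 2 * ((n : ℝ) + 1 / 4) := by
    refine monotone_nat_of_le_succ fun n => ?_
    rw [centralProb_succ, mul_pow, mul_assoc]
    refine mul_le_mul_of_nonneg_left ?_ (sq_nonneg _)
    rw [div_pow, div_mul_eq_mul_div, le_div_iff₀ (by positivity)]
    push_cast
    nlinarith [n.cast_nonneg (α := ℝ)]
  have hlim : Filter.Tendsto (fun n : ℕ => centralProb n ^ 2 * ((n : ℝ) + 1 / 4)) Filter.atTop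
      (nhds (1 / Real.pi)) := by
    have h1 : (fun n : ℕ => centralProb n ^ 2 * ((n : ℝ) + 1 / 4)) =
        fun n : ℕ => (Real.Wallis.W n)⁻¹ * (1 / 2 - 1 / 4 * (1 / (2 * (n : ℝ) + 1))) := by
      funext n
      have h := wallis_mul_centralProb_sq n
      have hW := (Real.Wallis.W_pos n).ne'
      have : centralProb n ^ 2 = (Real.Wallis.W n)⁻¹ * (1 / (2 * (n : ℝ) + 1)) := by
        field_simp
        linarith
      rw [this]
      field_simp
      ring
    rw [h1]
    have h2 : Filter.Tendsto (fun n : ℕ => 1 / (2 * (n : ℝ) + 1)) Filter.atTop (nhds 0) := by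
      refine Filter.Tendsto.div_atTop tendsto_const_nhds ?_
      exact Filter.tendsto_atTop_add_const_right _ _
        (tendsto_natCast_atTop_atTop.const_mul_atTop (by norm_num))
    have h3 := (Real.Wallis.tendsto_W_nhds_pi_div_two.inv₀ (by positivity)).mul
      ((h2.const_mul (1 / 4)).const_sub (1 / 2))
    convert h3 using 2
    field_simp
    ring
  exact hmono.ge_of_tendsto hlim n

section betaMean

variable {f g : ℝ → ℝ}

lemma intervalIntegrable_betaMean (hf : Continuous f) (a b : ℝ) :
    IntervalIntegrable (fun t => (1 + Real.cos t) * f ((1 - Real.cos t) / 2)) volume a b :=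
  Continuous.intervalIntegrable (by fun_prop) _ _

lemma betaMean_add (hf : Continuous f) (hg : Continuous g) :
    betaMean (fun x => f x + g x) = betaMean f + betaMean g := by
  unfold betaMean
  rw [← mul_add, ← intervalIntegral.integral_add (intervalIntegrable_betaMean hf _ _)
    (intervalIntegrable_betaMean hg _ _)]
  simp only [mul_add]

lemma betaMean_const_mul (c : ℝ) (f : ℝ → ℝ) :
    betaMean (fun x => c * f x) = c * betaMean f := by
  unfold betaMean
  rw [mul_left_comm, ← intervalIntegral.integral_const_mul c]
  congr 2
  funext t
  ring

lemma betaMean_sub (hf : Continuous f) (hg : Continuous g) :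
    betaMean (fun x => f x - g x) = betaMean f - betaMean g := by
  have h := betaMean_add hf (g := fun x => -1 * g x) (by fun_prop)
  rw [betaMean_const_mul] at h
  simpa [sub_eq_add_neg] using h

lemma betaMean_eq_symm (hf : Continuous f) :
    betaMean f = betaMean (fun x => f x / 2) +
      (1 / Real.pi) * ∫ t in (0 : ℝ)..Real.pi,
        (1 - Real.cos t) * (f ((1 + Real.cos t) / 2) / 2) := by
  have h : ∀ f : ℝ → ℝ, betaMean f = (1 / Real.pi) * ∫ t in (0 : ℝ)..Real.pi,
        (1 - Real.cos t) * (f ((1 + Real.cos t) / 2)) := by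
    intro f
    unfold betaMean
    congr 1
    have := intervalIntegral.integral_comp_sub_left
      (fun t => (1 + Real.cos t) * f ((1 - Real.cos t) / 2)) (a := 0) (b := Real.pi) Real.pi
    simp only [sub_zero, sub_self, Real.cos_pi_sub] at this
    rw [← this]
    congr 1
    funext t
    ring_nf
  rw [← h fun x => f x / 2, ← betaMean_add (by fun_prop) (by fun_prop)]
  simp

/-- Reflecting `x` to `1 - x` gives a criterion for a nonnegative mean. -/
lemma betaMean_nonneg_of_symm (hf : Continuous f)
    (h : ∀ x, 0 ≤ x → x ≤ 1 → 0 ≤ (1 - x) * f x + x * f (1 - x)) : 0 ≤ betaMean f := by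
  rw [betaMean_eq_symm hf]
  unfold betaMean
  rw [← mul_add, ← intervalIntegral.integral_add (Continuous.intervalIntegrable (by fun_prop) _ _)
    (Continuous.intervalIntegrable (by fun_prop) _ _)]
  refine mul_nonneg (by positivity) (intervalIntegral.integral_nonneg Real.pi_pos.le ?_)
  intro t _
  have h1 := Real.cos_le_one t
  have h2 := Real.neg_one_le_cos t
  have := h ((1 - Real.cos t) / 2) (by linarith) (by linarith)
  have e : 1 - (1 - Real.cos t) / 2 = (1 + Real.cos t) / 2 := by ring
  rw [e] at this
  linarith

/-- It suffices to check the reflection criterion on the upper half of the interval. -/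
lemma betaMean_nonneg_of_symm_half (hf : Continuous f)
    (h : ∀ u, 1 / 2 ≤ u → u ≤ 1 → 0 ≤ u * f (1 - u) + (1 - u) * f u) : 0 ≤ betaMean f := by
  refine betaMean_nonneg_of_symm hf fun x hx0 hx1 => ?_
  rcases le_total x (1 / 2) with hx | hx
  · have := h (1 - x) (by linarith) (by linarith)
    rw [sub_sub_cancel] at this
    linarith
  · have := h x hx hx1
    linarith

lemma betaMean_nonneg (h : ∀ x, 0 ≤ x → x ≤ 1 → 0 ≤ f x) : 0 ≤ betaMean f := by
  refine mul_nonneg (by positivity) (intervalIntegral.integral_nonneg Real.pi_pos.le ?_)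
  intro t _
  have h1 := Real.cos_le_one t
  have h2 := Real.neg_one_le_cos t
  exact mul_nonneg (by linarith) (h _ (by linarith) (by linarith))

lemma betaMean_mono (hf : Continuous f) (hg : Continuous g)
    (h : ∀ x, 0 ≤ x → x ≤ 1 → f x ≤ g x) : betaMean f ≤ betaMean g := by
  have := betaMean_nonneg (f := fun x => g x - f x) fun x h0 h1 => sub_nonneg.2 (h x h0 h1)
  rw [betaMean_sub hg hf] at this
  linarith

lemma betaMean_by_parts {h h' : ℝ → ℝ} (hh : ∀ x, HasDerivAt h (h' x) x) (hh' : Continuous h') :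
    betaMean (fun x => (1 - 4 * x) * h x + 2 * x * (1 - x) * h' x) = 0 := by
  have hc : Continuous h := continuous_iff_continuousAt.2 fun x => (hh x).continuousAt
  have key : ∀ t ∈ Set.uIcc 0 Real.pi,
      HasDerivAt (fun t => Real.sin t * ((1 + Real.cos t) * h ((1 - Real.cos t) / 2)))
        ((1 + Real.cos t) * ((1 - 4 * ((1 - Real.cos t) / 2)) * h ((1 - Real.cos t) / 2) +
          2 * ((1 - Real.cos t) / 2) * (1 - (1 - Real.cos t) / 2) * h' ((1 - Real.cos t) / 2)))
        t := by
    intro t _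
    have h1 : HasDerivAt (fun t => (1 - Real.cos t) / 2) (Real.sin t / 2) t := by
      simpa using ((Real.hasDerivAt_cos t).const_sub 1).div_const 2
    have h2 := (hh ((1 - Real.cos t) / 2)).comp t h1
    have h3 := (Real.hasDerivAt_sin t).mul (((Real.hasDerivAt_cos t).const_add 1).mul h2)
    refine h3.congr_deriv ?_
    simp only [Function.comp, Pi.mul_apply]
    have := Real.sin_sq_add_cos_sq t
    have e : Real.sin t ^ 2 = 1 - Real.cos t ^ 2 := by linarith
    linear_combination ((1 + Real.cos t) * h' ((1 - Real.cos t) / 2) / 2 -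
      h ((1 - Real.cos t) / 2)) * e
  unfold betaMean
  rw [intervalIntegral.integral_eq_sub_of_hasDerivAt key
    (Continuous.intervalIntegrable (by fun_prop) _ _)]
  simp

lemma hasDerivAt_betaMean {F F' : ℝ → ℝ → ℝ} (hF : ∀ z, Continuous (F z))
    (hF' : Continuous F'.uncurry) (hd : ∀ z x, HasDerivAt (fun z => F z x) (F' z x) z) (z : ℝ) :
    HasDerivAt (fun z => betaMean (F z)) (betaMean (F' z)) z := by
  have hF'z : ∀ z, Continuous (F' z) := fun z => hF'.comp (by fun_prop : Continuous fun x => (z, x))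
  set G : ℝ × ℝ → ℝ := fun q => (1 + Real.cos q.2) * F' q.1 ((1 - Real.cos q.2) / 2) with hG
  have hGc : Continuous G := by
    have : Continuous fun q : ℝ × ℝ => F'.uncurry (q.1, (1 - Real.cos q.2) / 2) :=
      hF'.comp (by fun_prop)
    exact Continuous.mul (by fun_prop) this
  obtain ⟨C, hC⟩ := ((isCompact_Icc (a := z - 1) (b := z + 1)).prod
    (isCompact_uIcc (a := (0 : ℝ)) (b := Real.pi))).exists_bound_of_continuousOn hGc.continuousOn
  refine HasDerivAt.const_mul _ ?_
  refine (intervalIntegral.hasDerivAt_integral_of_dominated_loc_of_deriv_le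
    (F' := fun z t => (1 + Real.cos t) * F' z ((1 - Real.cos t) / 2))
    (s := Set.Icc (z - 1) (z + 1)) (bound := fun _ => C)
    (Icc_mem_nhds (by linarith) (by linarith)) ?_ ?_ ?_ ?_ ?_ ?_).2
  · refine Filter.Eventually.of_forall fun y => ?_
    have := hF y
    exact Continuous.aestronglyMeasurable (by fun_prop)
  · exact intervalIntegrable_betaMean (hF z) _ _
  · have := hF'z z
    exact Continuous.aestronglyMeasurable (by fun_prop)
  · refine Filter.Eventually.of_forall fun t ht y hy => hC (y, t) ⟨hy, Set.uIoc_subset_uIcc ht⟩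
  · exact intervalIntegrable_const
  · exact Filter.Eventually.of_forall fun t _ y _ => (hd y _).const_mul _

lemma integral_cos_pow_add_two (n : ℕ) : ∫ t in (0 : ℝ)..Real.pi, Real.cos t ^ (n + 2) =
    (n + 1) / (n + 2) * ∫ t in (0 : ℝ)..Real.pi, Real.cos t ^ n := by
  rw [integral_cos_pow]
  simp

lemma integral_cos_pow_even (k : ℕ) :
    ∫ t in (0 : ℝ)..Real.pi, Real.cos t ^ (2 * k) = Real.pi * centralProb k := by
  induction k with
  | zero => simp [centralProb]
  | succ k ih =>
    rw [mul_add, mul_one, integral_cos_pow_add_two, ih, centralProb_succ]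
    push_cast
    ring

lemma integral_cos_pow_odd (k : ℕ) :
    ∫ t in (0 : ℝ)..Real.pi, Real.cos t ^ (2 * k + 1) = 0 := by
  induction k with
  | zero => simp
  | succ k ih =>
    rw [show 2 * (k + 1) + 1 = 2 * k + 1 + 2 by ring, integral_cos_pow_add_two, ih, mul_zero]

lemma betaMean_one_sub_two_mul_pow (n : ℕ) : betaMean (fun x => (1 - 2 * x) ^ n) =
    (1 / Real.pi) * ((∫ t in (0 : ℝ)..Real.pi, Real.cos t ^ n) +
      ∫ t in (0 : ℝ)..Real.pi, Real.cos t ^ (n + 1)) := by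
  unfold betaMean
  rw [← intervalIntegral.integral_add (Continuous.intervalIntegrable (by fun_prop) _ _)
    (Continuous.intervalIntegrable (by fun_prop) _ _)]
  congr 2
  funext t
  ring

lemma betaMean_one_sub_two_mul_pow_even (k : ℕ) :
    betaMean (fun x => (1 - 2 * x) ^ (2 * k)) = centralProb k := by
  rw [betaMean_one_sub_two_mul_pow, integral_cos_pow_even, integral_cos_pow_odd]
  field_simp
  ring

lemma betaMean_one_sub_two_mul_pow_odd (k : ℕ) :
    betaMean (fun x => (1 - 2 * x) ^ (2 * k + 1)) = centralProb (k + 1) := by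
  rw [betaMean_one_sub_two_mul_pow, show 2 * k + 1 + 1 = 2 * (k + 1) by ring,
    integral_cos_pow_even, integral_cos_pow_odd]
  field_simp
  ring

lemma betaMean_one_sub_pow (M : ℕ) :
    betaMean (fun x => (1 - x) ^ M) = 2 * centralProb (M + 1) := by
  induction M with
  | zero =>
    have := betaMean_one_sub_two_mul_pow_even 0
    simp only [mul_zero, pow_zero] at this ⊢
    rw [this]
    simp [centralProb]
  | succ M ih =>
    have h := betaMean_by_parts (h := fun x => (1 - x) ^ M)
      (h' := fun x => M * (1 - x) ^ (M - 1) * (-1))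
      (fun x => ((hasDerivAt_id x).const_sub 1).pow M) (by fun_prop)
    have e : (fun x : ℝ => (1 - 4 * x) * (1 - x) ^ M +
        2 * x * (1 - x) * (M * (1 - x) ^ (M - 1) * (-1))) =
        fun x : ℝ => (2 * (M : ℝ) + 4) * (1 - x) ^ (M + 1) - (2 * (M : ℝ) + 3) * (1 - x) ^ M := by
      funext x
      rcases M with _ | M
      · simp
        ring
      · rw [Nat.add_sub_cancel]
        push_cast
        ring
    rw [e, betaMean_sub (by fun_prop) (by fun_prop), betaMean_const_mul, betaMean_const_mul,
      ih] at h
    rw [centralProb_succ]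
    push_cast
    have h0 : (2 * (M : ℝ) + 4) ≠ 0 := by positivity
    have h1 : betaMean (fun x => (1 - x) ^ (M + 1)) =
      (2 * M + 3) * (2 * centralProb (M + 1)) / (2 * M + 4) := by
      rw [eq_div_iff h0]
      linarith
    rw [h1, show 2 * ((M : ℝ) + 1) + 2 = 2 * M + 4 by ring]
    field_simp
    ring

end betaMean

/-- Interior local maxima of `w z ^ 2 * (A + B * z)` satisfy the first and second order conditions
in the hypothesis `hint`. -/
lemma sq_mul_affine_le {w w' w'' : ℝ → ℝ} {A B a b c : ℝ} (hc : 0 ≤ c)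
    (hw : ∀ z, HasDerivAt w (w' z) z) (hw' : ∀ z, HasDerivAt w' (w'' z) z)
    (hAB : ∀ z ∈ Set.Icc a b, 0 < A + B * z)
    (ha : w a ^ 2 * (A + B * a) ≤ c) (hb : w b ^ 2 * (A + B * b) ≤ c)
    (hint : ∀ z ∈ Set.Ioo a b, 2 * w' z * (A + B * z) + w z * B = 0 →
      w z * w'' z ≤ 3 * w' z ^ 2 → w z ^ 2 * (A + B * z) ≤ c) :
    ∀ z ∈ Set.Icc a b, w z ^ 2 * (A + B * z) ≤ c := by
  intro z hz
  set F : ℝ → ℝ := fun z => w z ^ 2 * (A + B * z) with hF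
  have hF1 : ∀ z, HasDerivAt F (2 * w z * w' z * (A + B * z) + w z ^ 2 * B) z := by
    intro z
    have := ((hw z).pow 2).mul (((hasDerivAt_id z).const_mul B).const_add A)
    refine this.congr_deriv ?_
    simp
  have hF2 : ∀ z, HasDerivAt (fun z => 2 * w z * w' z * (A + B * z) + w z ^ 2 * B)
      (2 * (w' z ^ 2 + w z * w'' z) * (A + B * z) + 4 * w z * w' z * B) z := by
    intro z
    have := ((((hw z).const_mul 2).mul (hw' z)).mul
      (((hasDerivAt_id z).const_mul B).const_add A)).add (((hw z).pow 2).mul_const B)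
    refine this.congr_deriv ?_
    simp
    ring
  have hFc : Continuous F := continuous_iff_continuousAt.2 fun z => (hF1 z).continuousAt
  obtain ⟨m, hm, hmax⟩ := isCompact_Icc.exists_isMaxOn ⟨z, hz⟩ hFc.continuousOn
  refine (hmax hz).trans ?_
  rcases eq_or_lt_of_le hm.1 with rfl | h1
  · exact ha
  rcases eq_or_lt_of_le hm.2 with rfl | h2
  · exact hb
  by_cases hwm : w m = 0
  · simpa [hF, hwm] using hc
  have hmem : Set.Icc a b ∈ nhds m := Icc_mem_nhds h1 h2
  have hloc : IsLocalMax F m := hmax.isLocalMax hmem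
  have hd : 2 * w m * w' m * (A + B * m) + w m ^ 2 * B = 0 := hloc.hasDerivAt_eq_zero (hF1 m)
  have hd' : 2 * w' m * (A + B * m) + w m * B = 0 := by
    have : w m * (2 * w' m * (A + B * m) + w m * B) = 0 := by linarith
    exact (mul_eq_zero.1 this).resolve_left hwm
  refine hint m ⟨h1, h2⟩ hd' ?_
  by_contra! hlt
  have hpos := hAB m hm
  have hderiv : deriv F = fun z => 2 * w z * w' z * (A + B * z) + w z ^ 2 * B :=
    funext fun z => (hF1 z).deriv
  have hsec : 0 < deriv (deriv F) m := by
    rw [hderiv, (hF2 m).deriv]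
    have : 2 * (w' m ^ 2 + w m * w'' m) * (A + B * m) + 4 * w m * w' m * B =
        2 * (A + B * m) * (w m * w'' m - 3 * w' m ^ 2) := by
      linear_combination 4 * w' m * hd'
    rw [this]
    exact mul_pos (by linarith) (by linarith)
  have hmin : IsLocalMin F m :=
    isLocalMin_of_deriv_deriv_pos hsec ((hF1 m).deriv.trans hd) hFc.continuousAt
  have hconst : F =ᶠ[nhds m] fun _ => F m :=
    (hloc.and hmin).mono fun x hx => le_antisymm hx.1 hx.2
  have : deriv (deriv F) m = 0 := by
    have := (Filter.EventuallyEq.deriv hconst).deriv_eq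
    rw [this]
    simp
  exact hsec.ne' this

/-- The mean of `S x * x ^ i * (1 - z * x) ^ m`. -/
noncomputable def tiltedMean (S : ℝ → ℝ) (i m : ℕ) (z : ℝ) : ℝ :=
  betaMean fun x => S x * x ^ i * (1 - z * x) ^ m

lemma hasDerivAt_tiltedMean {S : ℝ → ℝ} (hS : Continuous S) (i m : ℕ) (z : ℝ) :
    HasDerivAt (tiltedMean S i (m + 1)) (-((m : ℝ) + 1) * tiltedMean S (i + 1) m z) z := by
  unfold tiltedMean
  rw [← betaMean_const_mul]
  refine hasDerivAt_betaMean (F := fun z x => S x * x ^ i * (1 - z * x) ^ (m + 1))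
    (F' := fun z x => -((m : ℝ) + 1) * (S x * x ^ (i + 1) * (1 - z * x) ^ m)) ?_ ?_ ?_ z
  · intro z
    fun_prop
  · have : Continuous fun q : ℝ × ℝ =>
      -((m : ℝ) + 1) * (S q.2 * q.2 ^ (i + 1) * (1 - q.1 * q.2) ^ m) := by fun_prop
    exact this
  · intro z x
    have := ((((hasDerivAt_id z).mul_const x).const_sub 1).pow (m + 1)).const_mul (S x * x ^ i)
    refine this.congr_deriv ?_
    simp
    ring

lemma betaMean_one_sub_pow_sq_mul_le (M : ℕ) :
    betaMean (fun x => (1 - x) ^ M) ^ 2 * ((M : ℝ) / 2 + 5 / 8) ≤ 2 / Real.pi := by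
  rw [betaMean_one_sub_pow]
  have h := centralProb_sq_mul_le (M + 1)
  push_cast at h
  calc _ = 2 * (centralProb (M + 1) ^ 2 * ((M : ℝ) + 1 + 1 / 4)) := by ring
    _ ≤ 2 * (1 / Real.pi) := by linarith
    _ = _ := by ring

lemma betaMean_one_sub_two_mul_pow_sq_mul_le (n : ℕ) :
    betaMean (fun x => (1 - 2 * x) ^ n) ^ 2 * ((n : ℝ) + 1 / 4) ≤ 2 / Real.pi := by
  rcases Nat.even_or_odd' n with ⟨k, rfl | rfl⟩
  · rw [betaMean_one_sub_two_mul_pow_even]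
    have h := centralProb_sq_mul_le k
    push_cast
    have : 0 ≤ centralProb k ^ 2 := sq_nonneg _
    rw [show 2 / Real.pi = 2 * (1 / Real.pi) by ring]
    nlinarith
  · rw [betaMean_one_sub_two_mul_pow_odd]
    have h := centralProb_sq_mul_le (k + 1)
    push_cast at h ⊢
    have : 0 ≤ centralProb (k + 1) ^ 2 := sq_nonneg _
    rw [show 2 / Real.pi = 2 * (1 / Real.pi) by ring]
    nlinarith

lemma half_le_two_div_pi : 1 / 2 ≤ 2 / Real.pi := by
  rw [div_le_div_iff₀ (by norm_num) Real.pi_pos]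
  linarith [Real.pi_le_four]

lemma betaMean_one : betaMean (fun _ => 1) = 1 := by
  have := betaMean_one_sub_two_mul_pow_even 0
  simpa [centralProb] using this

/-- The contiguity relation for the means of `x ^ i * (1 - z * x) ^ (m + 2 - i)`. -/
lemma tiltedMean_one_relation (m : ℕ) (z : ℝ) :
    tiltedMean (fun _ => 1) 0 (m + 2) z
      + (-4 + 3 * z - 2 * z * (m + 2)) * tiltedMean (fun _ => 1) 1 (m + 1) z
      + 2 * z * (m + 1) * (1 - z) * tiltedMean (fun _ => 1) 2 m z = 0 := by
  have h := betaMean_by_parts (h := fun x => (1 - z * x) ^ (m + 1))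
    (h' := fun x => ((m + 1 : ℕ) : ℝ) * (1 - z * x) ^ m * (-z))
    (fun x => by
      have := ((((hasDerivAt_id x).const_mul z).const_sub 1).pow (m + 1))
      refine this.congr_deriv ?_
      simp) (by fun_prop)
  rw [← h]
  unfold tiltedMean
  rw [← betaMean_const_mul, ← betaMean_const_mul, ← betaMean_add (by fun_prop) (by fun_prop),
    ← betaMean_add (by fun_prop) (by fun_prop)]
  congr 1
  funext x
  push_cast
  ring

lemma betaMean_one_sub_mul_pow_sq_mul_le (M : ℕ) {z : ℝ} (hz0 : 0 ≤ z) (hz2 : z ≤ 2) :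
    betaMean (fun x => (1 - z * x) ^ M) ^ 2 * ((M : ℝ) * z / 2 + 1 / 4) ≤ 2 / Real.pi := by
  have hpi := half_le_two_div_pi
  obtain _ | _ | m := M
  · simp only [pow_zero, betaMean_one]
    norm_num
    linarith
  · have h4 : betaMean (fun x => 1 - 4 * x) = 0 := by
      simpa using betaMean_by_parts (h := fun _ => 1) (h' := fun _ => 0)
        (fun x => hasDerivAt_const x 1) continuous_const
    have hx : betaMean (fun x => x) = 1 / 4 := by
      rw [betaMean_sub (by fun_prop) (by fun_prop), betaMean_const_mul, betaMean_one] at h4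
      linarith
    simp only [zero_add, pow_one]
    rw [betaMean_sub (by fun_prop) (by fun_prop), betaMean_const_mul, betaMean_one, hx]
    push_cast
    nlinarith [mul_nonneg hz0 (sub_nonneg.2 hz2), mul_nonneg hz0 (mul_nonneg hz0 (sub_nonneg.2 hz2)),
      sq_nonneg (z - 1)]
  set a : ℝ → ℝ := tiltedMean (fun _ => 1) 0 (m + 2) with ha
  have hav : ∀ z, a z = betaMean (fun x => (1 - z * x) ^ (m + 2)) := by
    intro z
    simp [ha, tiltedMean]
  set w' : ℝ → ℝ := fun z => -((m : ℝ) + 1 + 1) * tiltedMean (fun _ => 1) 1 (m + 1) z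
  set w'' : ℝ → ℝ := fun z => -((m : ℝ) + 1 + 1) * (-((m : ℝ) + 1) * tiltedMean (fun _ => 1) 2 m z)
  have hw : ∀ z, HasDerivAt a (w' z) z := fun z => by
    have := hasDerivAt_tiltedMean (S := fun _ => 1) continuous_const 0 (m + 1) z
    push_cast at this
    exact this
  have hw' : ∀ z, HasDerivAt w' (w'' z) z := fun z =>
    (hasDerivAt_tiltedMean (S := fun _ => 1) continuous_const 1 m z).const_mul _
  have hint : ∀ z, 0 < z → z ≠ 1 →
      2 * w' z * (1 / 4 + ((m : ℝ) + 2) / 2 * z) + a z * (((m : ℝ) + 2) / 2) = 0 →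
      a z * w'' z ≤ 3 * w' z ^ 2 →
      a z ^ 2 * (1 / 4 + ((m : ℝ) + 2) / 2 * z) ≤ 2 / Real.pi := by
    intro z hz hz1 h1 h2
    have hrel := tiltedMean_one_relation m z
    rw [← ha] at hrel
    simp only [w', w''] at h1 h2
    generalize tiltedMean (fun _ => 1) 1 (m + 1) z = b at *
    generalize tiltedMean (fun _ => 1) 2 m z = c at *
    have hm : (0 : ℝ) ≤ m := m.cast_nonneg
    have hab : a z = (2 * (m + 2) * z + 1) * b := by
      have : ((m : ℝ) + 2) * (a z - (2 * (m + 2) * z + 1) * b) = 0 := by linarith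
      have := (mul_eq_zero.1 this).resolve_left (by positivity)
      linarith
    have hbc : 2 * z * (m + 1) * c = 3 * b := by
      have : (1 - z) * (2 * z * (m + 1) * c - 3 * b) = 0 := by
        rw [hab] at hrel
        linarith
      have := (mul_eq_zero.1 this).resolve_left (sub_ne_zero.2 hz1.symm)
      linarith
    have hb : b = 0 := by
      have h3 : ((m : ℝ) + 2) * (a z * (2 * z * (m + 1) * c)) ≤
          ((m : ℝ) + 2) * (2 * z * (3 * (m + 2) * b ^ 2)) := by
        have := mul_le_mul_of_nonneg_left h2 (by linarith : 0 ≤ 2 * z)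
        nlinarith
      have h4 := le_of_mul_le_mul_left h3 (by positivity)
      rw [hbc, hab] at h4
      have : b ^ 2 ≤ 0 := by nlinarith
      exact pow_eq_zero_iff two_ne_zero |>.1 (le_antisymm this (sq_nonneg b))
    rw [hab, hb]
    simp only [mul_zero, ne_eq, OfNat.ofNat_ne_zero, not_false_eq_true, zero_pow, zero_mul]
    positivity
  have hpos : ∀ z : ℝ, 0 ≤ z → 0 < 1 / 4 + ((m : ℝ) + 2) / 2 * z := fun z hz => by positivity
  have h1 : a 1 ^ 2 * (1 / 4 + ((m : ℝ) + 2) / 2 * 1) ≤ 2 / Real.pi := by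
    have := betaMean_one_sub_pow_sq_mul_le (m + 2)
    rw [hav]
    simp only [one_mul]
    push_cast at this
    nlinarith [sq_nonneg (betaMean fun x => (1 - x) ^ (m + 2))]
  have h0 : a 0 ^ 2 * (1 / 4 + ((m : ℝ) + 2) / 2 * 0) ≤ 2 / Real.pi := by
    rw [hav]
    simp [betaMean_one]
    linarith
  have h2 : a 2 ^ 2 * (1 / 4 + ((m : ℝ) + 2) / 2 * 2) ≤ 2 / Real.pi := by
    have := betaMean_one_sub_two_mul_pow_sq_mul_le (m + 2)
    rw [hav]
    push_cast at this
    linarith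
  rw [← hav]
  push_cast
  have : (((m : ℝ) + 1 + 1) * z / 2 + 1 / 4) = 1 / 4 + ((m : ℝ) + 2) / 2 * z := by ring
  rw [this]
  rcases le_total z 1 with h | h
  · exact sq_mul_affine_le (by positivity) hw hw' (fun z hz => hpos z hz.1) h0 h1
      (fun z hz => hint z hz.1 hz.2.ne) z ⟨hz0, h⟩
  · exact sq_mul_affine_le (by positivity) hw hw' (fun z hz => hpos z (by linarith [hz.1])) h1 h2
      (fun z hz => hint z (by linarith [hz.1]) hz.1.ne') z ⟨h, hz2⟩

lemma betaMean_mul_one_sub_pow_le_step (k m : ℕ) :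
    betaMean (fun x => (1 - 2 * x) ^ (2 * (k + 1)) * (1 - x) ^ (m + 1)) ≤
      betaMean (fun x => (1 - 2 * x) ^ (2 * k) * (1 - x) ^ (m + 1 + 4)) := by
  have h := betaMean_nonneg_of_symm_half (f := fun x =>
    (1 - 2 * x) ^ (2 * k) * (1 - x) ^ (m + 1 + 4) -
      (1 - 2 * x) ^ (2 * (k + 1)) * (1 - x) ^ (m + 1)) (by fun_prop) ?_
  · rw [betaMean_sub (by fun_prop) (by fun_prop)] at h
    linarith
  intro u hu0 hu1
  have e1 : (1 - 2 * (1 - u)) ^ 2 = (1 - 2 * u) ^ 2 := by ring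
  have e : u * ((1 - 2 * (1 - u)) ^ (2 * k) * (1 - (1 - u)) ^ (m + 1 + 4) -
      (1 - 2 * (1 - u)) ^ (2 * (k + 1)) * (1 - (1 - u)) ^ (m + 1)) + (1 - u) *
      ((1 - 2 * u) ^ (2 * k) * (1 - u) ^ (m + 1 + 4) -
        (1 - 2 * u) ^ (2 * (k + 1)) * (1 - u) ^ (m + 1)) =
      ((1 - 2 * u) ^ 2) ^ k * (u ^ 2 * (1 - u) ^ 2) *
        (u ^ m * (u ^ 2 + 2 * u - 1) + (1 - u) ^ m * (u ^ 2 - 4 * u + 2)) := by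
    rw [pow_mul, pow_mul, pow_mul, pow_mul, e1, sub_sub_cancel, pow_succ _ k]
    ring
  rw [e]
  refine mul_nonneg (by positivity) ?_
  have h1 : (1 - u) ^ m ≤ u ^ m := pow_le_pow_left₀ (by linarith) (by linarith) m
  have h2 : 0 ≤ (1 - u) ^ m := pow_nonneg (by linarith) m
  have h3 : 0 ≤ u ^ 2 + 2 * u - 1 := by nlinarith
  calc (0 : ℝ) ≤ (1 - u) ^ m * (u ^ 2 + (1 - u) ^ 2) := by positivity
    _ = (1 - u) ^ m * (u ^ 2 + 2 * u - 1) + (1 - u) ^ m * (u ^ 2 - 4 * u + 2) := by ring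
    _ ≤ _ := by
      have := mul_le_mul_of_nonneg_right h1 h3
      linarith

lemma betaMean_mul_one_sub_pow_le (k m : ℕ) :
    betaMean (fun x => (1 - 2 * x) ^ (2 * k) * (1 - x) ^ (m + 1)) ≤
      betaMean (fun x => (1 - x) ^ (m + 1 + 4 * k)) := by
  induction k generalizing m with
  | zero => simp
  | succ k ih =>
    refine (betaMean_mul_one_sub_pow_le_step k m).trans ((ih (m + 4)).trans_eq ?_)
    congr 1
    funext x
    ring

lemma tiltedMean_pow_relation (k m : ℕ) (z : ℝ) :
    tiltedMean (fun x => (1 - 2 * x) ^ (2 * k)) 0 (m + 2) z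
      + (-8 * k - 10 - 2 * z * (m + 2) + 3 * z) *
        tiltedMean (fun x => (1 - 2 * x) ^ (2 * k)) 1 (m + 1) z
      + 2 * (4 * k + 6 + z * (3 - z) * (m + 1)) *
        tiltedMean (fun x => (1 - 2 * x) ^ (2 * k)) 2 m z
      + (-2 * z * (4 * k + 2 * (m + 2) + 4)) *
        tiltedMean (fun x => (1 - 2 * x) ^ (2 * k)) 3 m z = 0 := by
  have h := betaMean_by_parts (h := fun x => (1 - 2 * x) ^ (2 * k + 1) * (1 - z * x) ^ (m + 1))
    (h' := fun x => ((2 * k + 1 : ℕ) : ℝ) * (1 - 2 * x) ^ (2 * k) * (-2) * (1 - z * x) ^ (m + 1) +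
      (1 - 2 * x) ^ (2 * k + 1) * (((m + 1 : ℕ) : ℝ) * (1 - z * x) ^ m * (-z)))
    (fun x => by
      have := ((((hasDerivAt_id x).const_mul 2).const_sub 1).pow (2 * k + 1)).mul
        ((((hasDerivAt_id x).const_mul z).const_sub 1).pow (m + 1))
      refine this.congr_deriv ?_
      simp) (by fun_prop)
  rw [← h]
  unfold tiltedMean
  rw [← betaMean_const_mul, ← betaMean_const_mul, ← betaMean_const_mul,
    ← betaMean_add (by fun_prop) (by fun_prop), ← betaMean_add (by fun_prop) (by fun_prop),
    ← betaMean_add (by fun_prop) (by fun_prop)]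
  congr 1
  funext x
  push_cast
  ring

lemma tiltedMean_pow_nonneg (k i m : ℕ) {z : ℝ} (hz1 : z ≤ 1) :
    0 ≤ tiltedMean (fun x => (1 - 2 * x) ^ (2 * k)) i m z := by
  refine betaMean_nonneg fun x hx0 hx1 => ?_
  have : 0 ≤ 1 - z * x := by nlinarith
  have h2 : 0 ≤ (1 - 2 * x) ^ (2 * k) := by
    rw [pow_mul]
    positivity
  positivity

lemma tiltedMean_pow_three_ge (k m : ℕ) {z : ℝ} (hz1 : z ≤ 1) (t : ℝ) :
    2 * t * tiltedMean (fun x => (1 - 2 * x) ^ (2 * k)) 2 m z -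
      t ^ 2 * (tiltedMean (fun x => (1 - 2 * x) ^ (2 * k)) 1 (m + 1) z +
        z * tiltedMean (fun x => (1 - 2 * x) ^ (2 * k)) 2 m z) ≤
      tiltedMean (fun x => (1 - 2 * x) ^ (2 * k)) 3 m z := by
  unfold tiltedMean
  rw [← betaMean_const_mul, ← betaMean_const_mul z, ← betaMean_add (by fun_prop) (by fun_prop),
    ← betaMean_const_mul, ← betaMean_sub (by fun_prop) (by fun_prop)]
  refine betaMean_mono (by fun_prop) (by fun_prop) fun x hx0 hx1 => ?_
  have h1 : 0 ≤ 1 - z * x := by nlinarith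
  have h2 : 0 ≤ (1 - 2 * x) ^ (2 * k) := by
    rw [pow_mul]
    positivity
  have h3 : 0 ≤ (1 - 2 * x) ^ (2 * k) * (1 - z * x) ^ m * (x * (x - t) ^ 2) := by positivity
  rw [← sub_nonneg]
  refine h3.trans_eq ?_
  ring

/-- The moment inequalities at an interior critical point force the first moment to vanish. -/
lemma critical_moment_eq_zero {k M z b c D : ℝ} (hk : k = 1 ∨ 2 ≤ k) (hM : 100 ≤ M) (hz0 : 0 ≤ z)
    (hz1 : z ≤ 1) (hb : 0 ≤ b) (hD : 0 ≤ D)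
    (hDt : ∀ t, 2 * t * c - t ^ 2 * (b + z * c) ≤ D)
    (hrel : (4 * k + 6 + z * (3 - z) * (M - 1)) * c =
      (9 / 2 - 3 / 2 * z) * b + z * (4 * k + 2 * M + 4) * D)
    (hsec : (M - 1) * ((8 * k + 2 * M * z + 1) * b) * c ≤ 3 * M * b ^ 2) : b = 0 := by
  by_contra hb0
  have hbp : 0 < b := lt_of_le_of_ne hb (Ne.symm hb0)
  have hk1 : 1 ≤ k := by rcases hk with h | h <;> linarith
  have hMz : 0 ≤ M * z := by positivity
  have hL : 0 < 8 * k + 2 * M * z + 1 := by nlinarith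
  have hcb : (M - 1) * (8 * k + 2 * M * z + 1) * c ≤ 3 * M * b := by
    have : b * ((M - 1) * (8 * k + 2 * M * z + 1) * c) ≤ b * (3 * M * b) := by linarith
    exact le_of_mul_le_mul_left this hbp
  have hg : 0 ≤ 4 * k + 6 + z * (3 - z) * (M - 1) := by
    have : 0 ≤ z * (3 - z) * (M - 1) := by
      apply mul_nonneg (mul_nonneg hz0 _) <;> linarith
    linarith
  -- The estimate without the third moment.
  have hbasic : (M - 1) * (36 * k + 9 / 2 - 12 * k * z - 3 / 2 * z) ≤ (12 * k + 18) * M := by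
    have hD' : 0 ≤ z * (4 * k + 2 * M + 4) * D :=
      mul_nonneg (mul_nonneg hz0 (by linarith)) hD
    have h1 : (9 / 2 - 3 / 2 * z) * b ≤ (4 * k + 6 + z * (3 - z) * (M - 1)) * c := by linarith
    have h2 := mul_le_mul_of_nonneg_left h1
      (mul_nonneg (by linarith : 0 ≤ M - 1) hL.le)
    have h3 := mul_le_mul_of_nonneg_left hcb hg
    have h4 : b * ((M - 1) * (36 * k + 9 / 2 - 12 * k * z - 3 / 2 * z)) ≤
        b * ((12 * k + 18) * M) := by linarith
    exact le_of_mul_le_mul_left h4 hbp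
  rcases hk with rfl | hk
  swap
  · nlinarith [mul_nonneg (by linarith : 0 ≤ M - 1) (mul_nonneg (by linarith : 0 ≤ k)
      (sub_nonneg.2 hz1)), mul_nonneg (by linarith : 0 ≤ M - 1) (sub_nonneg.2 hz1)]
  have hz : 3 / 4 ≤ z := by
    by_contra! hlt
    nlinarith
  set L := 2 * M * z + 9 with hLdef
  have hLp : 150 ≤ L := by nlinarith
  have hL0 : 0 < L := by linarith
  set t := 1 / L with ht
  have htL : t * L = 1 := by
    rw [ht]
    field_simp
  have ht0 : 0 < t := by positivity
  have ht1 : t ≤ 1 / 150 := by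
    rw [ht]
    exact one_div_le_one_div_of_le (by norm_num) hLp
  set q := z * (2 * M + 8) * t with hq
  have hqL : q * L = z * (2 * M + 8) := by
    rw [hq, mul_assoc, htL, mul_one]
  have hq1 : q ≤ 1 := by
    have : q * L ≤ 1 * L := by
      rw [hqL]
      nlinarith
    exact le_of_mul_le_mul_right this hL0
  have hq2 : 97 / 100 ≤ q := by
    have : 97 / 100 * L ≤ q * L := by
      rw [hqL]
      nlinarith
    exact le_of_mul_le_mul_right this hL0
  have hzq : z * q ≤ 1 := by nlinarith
  have hzq0 : 0 ≤ z * q := by nlinarith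
  have h1 : (9 / 2 - 3 / 2 * z - q * t) * b ≤
      (4 * 1 + 6 + z * (3 - z) * (M - 1) - 2 * q + z * q * t) * c := by
    have := mul_le_mul_of_nonneg_left (hDt t) (by nlinarith : 0 ≤ z * (2 * M + 8))
    have e : z * (2 * M + 8) * (2 * t * c - t ^ 2 * (b + z * c)) =
      2 * q * c - q * t * b - z * q * t * c := by
      rw [hq]
      ring
    rw [e] at this
    linarith
  have hcb' : (M - 1) * L * c ≤ 3 * M * b := by
    have : (8 * 1 + 2 * M * z + 1) = L := by
      rw [hLdef]
      ring
    rwa [this] at hcb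
  have hg' : 0 ≤ 4 * 1 + 6 + z * (3 - z) * (M - 1) - 2 * q + z * q * t := by
    have h5 : 0 ≤ z * (3 - z) * (M - 1) := by
      apply mul_nonneg (mul_nonneg hz0 _) <;> linarith
    have : 0 ≤ z * q * t := by positivity
    linarith
  have h2 := mul_le_mul_of_nonneg_left h1 (mul_nonneg (by linarith : 0 ≤ M - 1) hL0.le)
  have h3 := mul_le_mul_of_nonneg_left hcb' hg'
  have h4 : b * ((M - 1) * ((9 / 2 - 3 / 2 * z) * L - q)) ≤
      b * ((4 * 1 + 6 + z * (3 - z) * (M - 1) - 2 * q + z * q * t) * (3 * M)) := by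
    have e : (M - 1) * L * ((9 / 2 - 3 / 2 * z - q * t) * b) =
        b * ((M - 1) * ((9 / 2 - 3 / 2 * z) * L - q * (t * L))) := by ring
    rw [e, htL] at h2
    linarith
  have h5 := le_of_mul_le_mul_left h4 hbp
  have h6 : z * q * t ≤ 1 / 150 :=
    (mul_le_mul hzq ht1 ht0.le zero_le_one).trans_eq (one_mul _)
  have h7 : z * q * t * (3 * M) ≤ 1 / 150 * (3 * M) :=
    mul_le_mul_of_nonneg_right h6 (by linarith)
  have h8 : 97 / 100 * M ≤ q * M := mul_le_mul_of_nonneg_right hq2 (by linarith)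
  have h9 : 0 ≤ (M - 1) * (1 - z) := mul_nonneg (by linarith) (by linarith)
  rw [hLdef] at h5
  linarith

lemma tiltedMean_pow_sq_mul_le {k M : ℕ} (hk : 1 ≤ k) (hM : 100 ≤ M) {z : ℝ} (hz0 : 0 ≤ z)
    (hz1 : z ≤ 1) :
    betaMean (fun x => (1 - 2 * x) ^ (2 * k) * (1 - z * x) ^ M) ^ 2 *
      (2 * (k : ℝ) + (M : ℝ) * z / 2 + 1 / 4) ≤ 2 / Real.pi := by
  have hpi := half_le_two_div_pi
  obtain ⟨m, rfl⟩ : ∃ m, M = m + 2 := ⟨M - 2, by omega⟩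
  set S : ℝ → ℝ := fun x => (1 - 2 * x) ^ (2 * k) with hS
  have hSc : Continuous S := by fun_prop
  set a : ℝ → ℝ := tiltedMean S 0 (m + 2) with ha
  have hav : ∀ z, a z = betaMean (fun x => (1 - 2 * x) ^ (2 * k) * (1 - z * x) ^ (m + 2)) := by
    intro z
    simp [ha, tiltedMean, hS]
  set w' : ℝ → ℝ := fun z => -((m : ℝ) + 1 + 1) * tiltedMean S 1 (m + 1) z
  set w'' : ℝ → ℝ := fun z => -((m : ℝ) + 1 + 1) * (-((m : ℝ) + 1) * tiltedMean S 2 m z)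
  have hw : ∀ z, HasDerivAt a (w' z) z := fun z => by
    have := hasDerivAt_tiltedMean hSc 0 (m + 1) z
    push_cast at this
    exact this
  have hw' : ∀ z, HasDerivAt w' (w'' z) z := fun z =>
    (hasDerivAt_tiltedMean hSc 1 m z).const_mul _
  rw [← hav]
  push_cast
  rw [show (2 * (k : ℝ) + ((m : ℝ) + 2) * z / 2 + 1 / 4) =
    (2 * k + 1 / 4) + ((m : ℝ) + 2) / 2 * z by ring]
  refine sq_mul_affine_le (by positivity) hw hw' (a := 0) (b := 1) ?_ ?_ ?_ ?_ z ⟨hz0, hz1⟩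
  · intro z hz
    have := hz.1
    positivity
  · have := betaMean_one_sub_two_mul_pow_sq_mul_le (2 * k)
    rw [hav]
    simp only [zero_mul, sub_zero, one_pow, mul_one, mul_zero, add_zero]
    push_cast at this
    exact this
  · have h1 := betaMean_one_sub_pow_sq_mul_le (m + 1 + 1 + 4 * k)
    have h2 := betaMean_mul_one_sub_pow_le k (m + 1)
    have h3 := tiltedMean_pow_nonneg k 0 (m + 2) le_rfl
    rw [hav]
    have h4 : 0 ≤ betaMean fun x => (1 - 2 * x) ^ (2 * k) * (1 - 1 * x) ^ (m + 2) := by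
      rw [← hav]
      exact h3
    simp only [one_mul] at h4 ⊢
    have h5 := pow_le_pow_left₀ h4 h2 2
    push_cast at h1
    refine le_trans ?_ h1
    refine mul_le_mul h5 ?_ (by positivity) (sq_nonneg _)
    linarith
  · intro z hz h1 h2
    have hrel := tiltedMean_pow_relation k m z
    have hb := tiltedMean_pow_nonneg k 1 (m + 1) hz.2.le
    have hD := tiltedMean_pow_nonneg k 3 m hz.2.le
    have hDt := tiltedMean_pow_three_ge k m hz.2.le
    simp only [← hS] at hrel hb hD hDt
    rw [← ha] at hrel
    simp only [w', w''] at h1 h2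
    generalize tiltedMean S 1 (m + 1) z = b at *
    generalize tiltedMean S 2 m z = c at *
    generalize tiltedMean S 3 m z = D at *
    have hab : a z = (8 * k + 2 * (m + 2) * z + 1) * b := by
      have : ((m : ℝ) + 2) * (a z - (8 * k + 2 * (m + 2) * z + 1) * b) = 0 := by linarith
      have := (mul_eq_zero.1 this).resolve_left (by positivity)
      linarith
    have hb0 : b = 0 := by
      refine critical_moment_eq_zero (k := k) (M := (m : ℝ) + 2) ?_ ?_ hz.1.le hz.2.le hb hD hDt
        ?_ ?_
      · rcases hk.eq_or_lt with h | h
        · left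
          exact_mod_cast h.symm
        · right
          exact_mod_cast h
      · exact_mod_cast hM
      · rw [hab] at hrel
        linarith
      · rw [hab] at h2
        have h3 : ((m : ℝ) + 2) * (((m : ℝ) + 2 - 1) * ((8 * k + 2 * (m + 2) * z + 1) * b) * c) ≤
            ((m : ℝ) + 2) * (3 * (m + 2) * b ^ 2) := by linarith
        exact le_of_mul_le_mul_left h3 (by positivity)
    rw [hab, hb0]
    simp only [mul_zero, ne_eq, OfNat.ofNat_ne_zero, not_false_eq_true, zero_pow, zero_mul]
    positivity

section sign

lemma betaMean_sq_mul_nonneg_of_even {a b : ℕ} {p : ℝ} (ha : Even a)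
    (h : Even b ∨ p ≤ 1 / 2) (hp : 0 ≤ p) :
    0 ≤ betaMean (fun x => x ^ 2 * ((1 - 2 * x) ^ a * (1 - 2 * p * x) ^ b)) := by
  refine betaMean_nonneg fun x hx0 hx1 => ?_
  refine mul_nonneg (sq_nonneg _) (mul_nonneg (ha.pow_nonneg _) ?_)
  rcases h with h | h
  · exact h.pow_nonneg _
  · refine pow_nonneg ?_ _
    nlinarith [mul_nonneg hp hx0]

lemma betaMean_sq_mul_nonneg_of_odd {a b : ℕ} {p : ℝ} (ha : Odd a) (hb : Odd b)
    (hp : 1 / 2 ≤ p) (hp1 : p ≤ 1) :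
    0 ≤ betaMean (fun x => x ^ 2 * ((1 - 2 * x) ^ a * (1 - 2 * p * x) ^ b)) := by
  refine betaMean_nonneg_of_symm_half (by fun_prop) fun u hu0 hu1 => ?_
  obtain ⟨b, rfl⟩ := hb
  have e : (1 - 2 * u) ^ a = -(2 * u - 1) ^ a := by
    rw [← ha.neg_pow]
    ring
  have e' : (1 - 2 * (1 - u)) ^ a = (2 * u - 1) ^ a := by
    ring_nf
  rw [e, e']
  have key : u * (1 - 2 * p * u) ^ (2 * b + 1) ≤
      (1 - u) * (1 - 2 * p * (1 - u)) ^ (2 * b + 1) := by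
    have hpos : 0 ≤ 1 - 2 * p * (1 - u) := by nlinarith
    rcases le_total (1 - 2 * p * u) 0 with h | h
    · have h1 : (1 - 2 * p * u) ^ (2 * b + 1) ≤ 0 := Odd.pow_nonpos ⟨b, rfl⟩ h
      have h2 : u * (1 - 2 * p * u) ^ (2 * b + 1) ≤ 0 :=
        mul_nonpos_of_nonneg_of_nonpos (by linarith) h1
      exact h2.trans (mul_nonneg (by linarith) (pow_nonneg hpos _))
    · rw [pow_succ, pow_succ, mul_comm (_ ^ _), mul_comm (_ ^ _), ← mul_assoc, ← mul_assoc]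
      refine mul_le_mul (by nlinarith) (pow_le_pow_left₀ h (by nlinarith) _) (pow_nonneg h _)
        (mul_nonneg (by linarith) hpos)
  have h0 : 0 ≤ u * (1 - u) * (2 * u - 1) ^ a :=
    mul_nonneg (mul_nonneg (by linarith) (by linarith)) (pow_nonneg (by linarith) _)
  have := mul_nonneg h0 (sub_nonneg.2 key)
  refine this.trans_eq ?_
  ring

lemma exists_sq_mul_mean_nonneg (K M : ℕ) {p : ℝ} (hp0 : 0 ≤ p) (hp1 : p ≤ 1) :
    0 ≤ betaMean (fun x => x ^ 2 * ((1 - 2 * x) ^ K * (1 - 2 * p * x) ^ M)) ∨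
    0 ≤ betaMean (fun x => x ^ 2 * ((1 - 2 * x) ^ K * (1 - 2 * p * x) ^ (M + 1))) ∨
    0 ≤ betaMean (fun x => x ^ 2 * ((1 - 2 * x) ^ (K + 1) * (1 - 2 * p * x) ^ M)) := by
  rcases Nat.even_or_odd K with hK | hK
  · rcases Nat.even_or_odd M with hM | hM
    · exact Or.inl (betaMean_sq_mul_nonneg_of_even hK (Or.inl hM) hp0)
    · exact Or.inr (Or.inl (betaMean_sq_mul_nonneg_of_even hK (Or.inl hM.add_one) hp0))
  · rcases le_total p (1 / 2) with hp | hp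
    · exact Or.inr (Or.inr (betaMean_sq_mul_nonneg_of_even hK.add_one (Or.inr hp) hp0))
    rcases Nat.even_or_odd M with hM | hM
    · exact Or.inr (Or.inr (betaMean_sq_mul_nonneg_of_even hK.add_one (Or.inl hM) hp0))
    · exact Or.inl (betaMean_sq_mul_nonneg_of_odd hK hM hp hp1)

end sign

section extremal

variable {ι : Type*} [Fintype ι]

/-- The mean of `∏ i, (1 - 2 * p i * x)`; for Bernoulli summands with parameters `p i` it is the
expected maximal probability of a symmetric binomial law with a random number of trials. -/
noncomputable def prodMean (p : ι → ℝ) : ℝ := betaMean fun x => ∏ i, (1 - 2 * p i * x)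

lemma continuous_prodMean : Continuous (prodMean : (ι → ℝ) → ℝ) := by
  unfold prodMean betaMean
  refine continuous_const.mul ?_
  refine intervalIntegral.continuous_parametric_intervalIntegral_of_continuous'
    (f := fun (p : ι → ℝ) t => (1 + Real.cos t) * ∏ i, (1 - 2 * p i * ((1 - Real.cos t) / 2))) ?_ _ _
  have : Continuous fun q : (ι → ℝ) × ℝ =>
      (1 + Real.cos q.2) * ∏ i, (1 - 2 * q.1 i * ((1 - Real.cos q.2) / 2)) := by fun_prop
  exact this

/-- The cube slice of parameter vectors with a given sum. -/
def cubeSlice (ι : Type*) [Fintype ι] (s : ℝ) : Set (ι → ℝ) :=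
  {q | (∀ i, q i ∈ Set.Icc (0 : ℝ) 1) ∧ ∑ i, q i = s}

lemma isCompact_cubeSlice (s : ℝ) : IsCompact (cubeSlice ι s) := by
  have h : cubeSlice ι s = (Set.univ.pi fun _ : ι => Set.Icc (0 : ℝ) 1) ∩ {q | ∑ i, q i = s} := by
    ext q
    simp only [cubeSlice, Set.mem_ofPred_eq, Set.mem_inter_iff, Set.mem_univ_pi]
  rw [h]
  exact (isCompact_univ_pi fun _ => isCompact_Icc).inter_right
    (isClosed_eq (by fun_prop) continuous_const)

lemma exists_extremal {s : ℝ} {p : ι → ℝ} (hp : p ∈ cubeSlice ι s) :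
    ∃ q ∈ cubeSlice ι s, (∀ r ∈ cubeSlice ι s, prodMean r ≤ prodMean q) ∧
      ∀ r ∈ cubeSlice ι s, prodMean r = prodMean q → ∑ i, q i ^ 2 ≤ ∑ i, r i ^ 2 := by
  obtain ⟨q₀, hq₀, hmax⟩ := (isCompact_cubeSlice s).exists_isMaxOn ⟨p, hp⟩
    continuous_prodMean.continuousOn
  have hK : IsCompact (cubeSlice ι s ∩ {q | prodMean q = prodMean q₀}) :=
    (isCompact_cubeSlice s).inter_right (isClosed_eq continuous_prodMean continuous_const)
  obtain ⟨q, hq, hmin⟩ := hK.exists_isMinOn ⟨q₀, hq₀, rfl⟩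
    (f := fun q => ∑ i, q i ^ 2) (by fun_prop)
  refine ⟨q, hq.1, fun r hr => (hmax hr).trans_eq hq.2.symm, fun r hr h => ?_⟩
  exact hmin ⟨hr, h.trans hq.2⟩

variable [DecidableEq ι]

/-- The second-order coefficient attached to a pair of coordinates. -/
noncomputable def pairCoeff (q : ι → ℝ) (i j : ι) : ℝ :=
  betaMean fun x => x ^ 2 * ∏ k ∈ (Finset.univ.erase i).erase j, (1 - 2 * q k * x)

lemma pairCoeff_comm (q : ι → ℝ) (i j : ι) : pairCoeff q i j = pairCoeff q j i := by
  unfold pairCoeff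
  rw [Finset.erase_right_comm]

/-- Move the amount `t` from coordinate `j` to coordinate `i`. -/
def transfer (q : ι → ℝ) (i j : ι) (t : ℝ) : ι → ℝ :=
  Function.update (Function.update q i (q i + t)) j (q j - t)

lemma transfer_of_mem_erase {q : ι → ℝ} {i j k : ι} (t : ℝ)
    (hk : k ∈ (Finset.univ.erase i).erase j) : transfer q i j t k = q k := by
  simp only [Finset.mem_erase, Finset.mem_univ, and_true] at hk
  simp [transfer, hk.1, hk.2]

omit [Fintype ι] in
lemma transfer_left (q : ι → ℝ) {i j : ι} (hij : i ≠ j) (t : ℝ) :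
    transfer q i j t i = q i + t := by
  simp [transfer, hij]

omit [Fintype ι] in
lemma transfer_right (q : ι → ℝ) (i j : ι) (t : ℝ) : transfer q i j t j = q j - t := by
  simp [transfer]

lemma prod_eq_mul_mul_erase {i j : ι} (hij : i ≠ j) (f : ι → ℝ) :
    ∏ k, f k = f i * (f j * ∏ k ∈ (Finset.univ.erase i).erase j, f k) := by
  rw [← Finset.mul_prod_erase _ _ (Finset.mem_univ i),
    ← Finset.mul_prod_erase (Finset.univ.erase i) _ (by simp [hij.symm] : j ∈ _)]

lemma sum_eq_add_add_erase {i j : ι} (hij : i ≠ j) (f : ι → ℝ) :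
    ∑ k, f k = f i + (f j + ∑ k ∈ (Finset.univ.erase i).erase j, f k) := by
  rw [← Finset.add_sum_erase _ _ (Finset.mem_univ i),
    ← Finset.add_sum_erase (Finset.univ.erase i) _ (by simp [hij.symm] : j ∈ _)]

lemma sum_transfer (q : ι → ℝ) {i j : ι} (hij : i ≠ j) (t : ℝ) (g : ℝ → ℝ) :
    ∑ k, g (transfer q i j t k) - ∑ k, g (q k) =
      g (q i + t) + g (q j - t) - g (q i) - g (q j) := by
  rw [sum_eq_add_add_erase hij, sum_eq_add_add_erase hij, transfer_left q hij, transfer_right,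
    Finset.sum_congr rfl fun k hk => by rw [transfer_of_mem_erase t hk]]
  ring

lemma prodMean_transfer (q : ι → ℝ) {i j : ι} (hij : i ≠ j) (t : ℝ) :
    prodMean (transfer q i j t) - prodMean q =
      4 * ((q i + t) * (q j - t) - q i * q j) * pairCoeff q i j := by
  unfold prodMean pairCoeff
  rw [← betaMean_sub (by fun_prop) (by fun_prop), ← betaMean_const_mul]
  congr 1
  funext x
  rw [prod_eq_mul_mul_erase hij, prod_eq_mul_mul_erase hij, transfer_left q hij, transfer_right,
    Finset.prod_congr rfl fun k hk => by rw [transfer_of_mem_erase t hk]]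
  ring

lemma transfer_mem_cubeSlice {s : ℝ} {q : ι → ℝ} (hq : q ∈ cubeSlice ι s) {i j : ι} (hij : i ≠ j)
    {t : ℝ} (hi : q i + t ∈ Set.Icc (0 : ℝ) 1) (hj : q j - t ∈ Set.Icc (0 : ℝ) 1) :
    transfer q i j t ∈ cubeSlice ι s := by
  refine ⟨fun k => ?_, ?_⟩
  · by_cases hkj : k = j
    · rw [hkj, transfer_right]
      exact hj
    by_cases hki : k = i
    · rw [hki, transfer_left q hij]
      exact hi
    rw [transfer_of_mem_erase t (by simp [hkj, hki])]
    exact hq.1 k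
  · have := sum_transfer q hij t id
    simp only [id] at this
    linarith [hq.2]

section properties

variable {s : ℝ} {q : ι → ℝ}

lemma pairCoeff_neg (hq : q ∈ cubeSlice ι s)
    (hmax : ∀ r ∈ cubeSlice ι s, prodMean r ≤ prodMean q)
    (hmin : ∀ r ∈ cubeSlice ι s, prodMean r = prodMean q → ∑ i, q i ^ 2 ≤ ∑ i, r i ^ 2)
    {i j : ι} (hij : q i ≠ q j) : pairCoeff q i j < 0 := by
  wlog hlt : q i < q j generalizing i j
  · rw [pairCoeff_comm]
    exact this hij.symm (lt_of_le_of_ne (not_lt.1 hlt) hij.symm)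
  have hne : i ≠ j := fun h => hij (by rw [h])
  set t := (q j - q i) / 2 with ht
  have hi := hq.1 i
  have hj := hq.1 j
  have hmem : transfer q i j t ∈ cubeSlice ι s :=
    transfer_mem_cubeSlice hq hne ⟨by linarith [hi.1], by linarith [hj.2]⟩
      ⟨by linarith [hi.1], by linarith [hj.2]⟩
  have h1 := hmax _ hmem
  have h2 := prodMean_transfer q hne t
  have h3 := sum_transfer q hne t (fun y => y ^ 2)
  have htp : 0 < t ^ 2 := by
    have : 0 < t := by linarith
    positivity
  have e1 : (q i + t) * (q j - t) - q i * q j = t ^ 2 := by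
    rw [ht]
    ring
  have e2 : (q i + t) ^ 2 + (q j - t) ^ 2 - q i ^ 2 - q j ^ 2 = -2 * t ^ 2 := by
    rw [ht]
    ring
  rw [e1] at h2
  simp only [e2] at h3
  by_contra! hc
  have h4 : 0 ≤ 4 * t ^ 2 * pairCoeff q i j := by positivity
  have := hmin _ hmem (by linarith)
  linarith

lemma eq_of_mem_Ioo (hq : q ∈ cubeSlice ι s)
    (hmax : ∀ r ∈ cubeSlice ι s, prodMean r ≤ prodMean q)
    (hmin : ∀ r ∈ cubeSlice ι s, prodMean r = prodMean q → ∑ i, q i ^ 2 ≤ ∑ i, r i ^ 2)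
    {i j : ι} (hi : q i ∈ Set.Ioo (0 : ℝ) 1) (hj : q j ∈ Set.Ioo (0 : ℝ) 1) : q i = q j := by
  by_contra hij
  wlog hlt : q i < q j generalizing i j
  · exact this hj hi (Ne.symm hij) (lt_of_le_of_ne (not_lt.1 hlt) (Ne.symm hij))
  have hne : i ≠ j := fun h => hij (by rw [h])
  have hc := pairCoeff_neg hq hmax hmin hij
  obtain ⟨e, he0, he⟩ := exists_between (lt_min hi.1 (sub_pos.2 hj.2))
  rw [lt_min_iff] at he
  have hmem : transfer q i j (-e) ∈ cubeSlice ι s :=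
    transfer_mem_cubeSlice hq hne ⟨by linarith, by linarith [hi.2]⟩
      ⟨by linarith [hj.1], by linarith⟩
  have h1 := hmax _ hmem
  have h2 := prodMean_transfer q hne (-e)
  have h3 : (q i + -e) * (q j - -e) - q i * q j < 0 := by nlinarith
  have h4 := mul_pos_of_neg_of_neg h3 hc
  linarith

end properties

omit [Fintype ι] [DecidableEq ι] in
/-- A product over coordinates with values in `{0, 1, p}`. -/
lemma prod_one_sub_eq {q : ι → ℝ} {p : ℝ} (hp : p ≠ 1) (h : ∀ i, q i = 0 ∨ q i = 1 ∨ q i = p)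
    (S : Finset ι) (x : ℝ) (hp0 : p ≠ 0) :
    ∏ k ∈ S, (1 - 2 * q k * x) = (1 - 2 * x) ^ (S.filter fun k => q k = 1).card *
      (1 - 2 * p * x) ^ (S.filter fun k => q k = p).card := by
  rw [← Finset.prod_const, ← Finset.prod_const, Finset.prod_filter, Finset.prod_filter,
    ← Finset.prod_mul_distrib]
  refine Finset.prod_congr rfl fun k _ => ?_
  rcases h k with h | h | h
  · simp [h, hp0.symm]
  · simp [h, hp.symm]
  · simp [h, hp]

lemma prodMean_le_of_card {p : ι → ℝ} (hp : ∀ i, p i ∈ Set.Icc (0 : ℝ) 1)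
    (hcard : 2 * ∑ i, p i + 300 ≤ Fintype.card ι) :
    prodMean p ≤ Real.sqrt (2 / Real.pi / (∑ i, p i + 1 / 4)) := by
  obtain ⟨q, hq, hmax, hmin⟩ := exists_extremal (s := ∑ i, p i) ⟨hp, rfl⟩
  refine (hmax p ⟨hp, rfl⟩).trans (Real.le_sqrt_of_sq_le ?_)
  have hs : 0 ≤ ∑ i, p i := Finset.sum_nonneg fun i _ => (hp i).1
  rw [le_div_iff₀ (by positivity)]
  obtain ⟨y, hy, hval⟩ : ∃ y ∈ Set.Ioo (0 : ℝ) 1, ∀ i, q i = 0 ∨ q i = 1 ∨ q i = y := by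
    by_cases hex : ∃ i, q i ∈ Set.Ioo (0 : ℝ) 1
    · obtain ⟨i, hi⟩ := hex
      refine ⟨q i, hi, fun j => ?_⟩
      rcases (hq.1 j).1.eq_or_lt with h | h
      · exact Or.inl h.symm
      rcases (hq.1 j).2.eq_or_lt with h' | h'
      · exact Or.inr (Or.inl h')
      · exact Or.inr (Or.inr (eq_of_mem_Ioo hq hmax hmin ⟨h, h'⟩ hi))
    · push Not at hex
      refine ⟨1 / 2, by norm_num, fun j => ?_⟩
      rcases (hq.1 j).1.eq_or_lt with h | h
      · exact Or.inl h.symm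
      rcases (hq.1 j).2.eq_or_lt with h' | h'
      · exact Or.inr (Or.inl h')
      · exact absurd ⟨h, h'⟩ (hex j)
  have hy0 : y ≠ 0 := hy.1.ne'
  have hy1 : y ≠ 1 := hy.2.ne
  have hprod := fun S x => prod_one_sub_eq hy1 hval S x hy0
  set K := (Finset.univ.filter fun k => q k = 1).card with hK
  set M := (Finset.univ.filter fun k => q k = y).card with hM
  have hPhi : prodMean q = betaMean fun x => (1 - 2 * x) ^ K * (1 - 2 * y * x) ^ M := by
    unfold prodMean
    simp only [hprod, ← hK, ← hM]
  have hsum : ∑ i, p i = K + M * y := by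
    rw [← hq.2, hK, hM, Finset.card_filter, Finset.card_filter]
    push_cast
    rw [Finset.sum_mul, ← Finset.sum_add_distrib]
    refine Finset.sum_congr rfl fun k _ => ?_
    rcases hval k with h | h | h
    · simp [h, hy0.symm]
    · simp [h, hy1.symm]
    · simp [h, hy1]
  have hpair : ∀ i j, q i ≠ q j → betaMean (fun x => x ^ 2 *
      ((1 - 2 * x) ^ (((Finset.univ.erase i).erase j).filter fun k => q k = 1).card *
      (1 - 2 * y * x) ^ (((Finset.univ.erase i).erase j).filter fun k => q k = y).card)) < 0 := by
    intro i j hij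
    have := pairCoeff_neg hq hmax hmin hij
    unfold pairCoeff at this
    simpa only [hprod] using this
  rw [hPhi, hsum]
  rcases Nat.eq_zero_or_pos K with hK0 | hK0
  · have := betaMean_one_sub_mul_pow_sq_mul_le M (z := 2 * y) (by linarith [hy.1])
      (by linarith [hy.2])
    simp only [hK0, pow_zero, one_mul, Nat.cast_zero, zero_add]
    rwa [show (M : ℝ) * y = M * (2 * y) / 2 by ring]
  rcases Nat.eq_zero_or_pos M with hM0 | hM0
  · have := betaMean_one_sub_two_mul_pow_sq_mul_le K
    simpa only [hM0, pow_zero, mul_one, Nat.cast_zero, zero_mul, add_zero] using this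
  obtain ⟨u, hu⟩ := Finset.card_pos.1 hK0
  obtain ⟨v, hv⟩ := Finset.card_pos.1 hM0
  simp only [Finset.mem_filter, Finset.mem_univ, true_and] at hu hv
  obtain ⟨K', hK'⟩ : ∃ K', K = K' + 1 := ⟨K - 1, by omega⟩
  obtain ⟨M', hM'⟩ : ∃ M', M = M' + 1 := ⟨M - 1, by omega⟩
  have hKu : ((Finset.univ.filter fun k => q k = 1).erase u).card = K' := by
    rw [Finset.card_erase_of_mem (by simp [hu])]
    omega
  have hMv : ((Finset.univ.filter fun k => q k = y).erase v).card = M' := by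
    rw [Finset.card_erase_of_mem (by simp [hv])]
    omega
  have huv := hpair u v (by rw [hu, hv]; exact hy1.symm)
  simp only [Finset.filter_erase] at hpair huv
  rw [Finset.erase_eq_of_notMem (a := v) (by simp [hv, hy1]),
    Finset.erase_eq_of_notMem (a := u) (s := Finset.univ.filter fun k => q k = y)
    (by simp [hu, hy1.symm]), hKu, hMv] at huv
  by_cases hz : ∃ w, q w = 0
  · obtain ⟨w, hw⟩ := hz
    have huw := hpair u w (by rw [hu, hw]; norm_num)
    have hvw := hpair v w (by rw [hv, hw]; exact hy0)
    rw [Finset.erase_eq_of_notMem (a := w) (by simp [hw]),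
      Finset.erase_eq_of_notMem (a := w) (by simp [hw, hy0.symm]),
      Finset.erase_eq_of_notMem (a := u) (s := Finset.univ.filter fun k => q k = y)
      (by simp [hu, hy1.symm]), hKu, ← hM, hM'] at huw
    rw [Finset.erase_eq_of_notMem (a := w) (by simp [hw]),
      Finset.erase_eq_of_notMem (a := w) (by simp [hw, hy0.symm]),
      Finset.erase_eq_of_notMem (a := v) (s := Finset.univ.filter fun k => q k = 1)
      (by simp [hv, hy1]), hMv, ← hK, hK'] at hvw
    exfalso
    rcases exists_sq_mul_mean_nonneg K' M' hy.1.le hy.2.le with h | h | h <;> linarith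
  · push Not at hz
    have hcardKM : Fintype.card ι = K + M := by
      rw [hK, hM, ← Finset.card_union_of_disjoint, ← Finset.card_univ]
      · congr 1
        ext k
        have := (hval k).resolve_left (hz k)
        simpa using this
      · rw [Finset.disjoint_filter]
        intro k _ h1 h2
        exact hy1 (h2.symm.trans h1)
    rw [hcardKM, hsum] at hcard
    push_cast at hcard
    have hKr : (0 : ℝ) ≤ K := K.cast_nonneg
    have hMr : (0 : ℝ) ≤ M := M.cast_nonneg
    have hyh : y ≤ 1 / 2 := by
      by_contra! h
      nlinarith
    have hM100 : 100 ≤ M := by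
      have : (100 : ℝ) ≤ M := by nlinarith [mul_nonneg hMr hy.1.le]
      exact_mod_cast this
    rcases Nat.even_or_odd K' with hev | hodd
    · exact absurd (betaMean_sq_mul_nonneg_of_even hev (Or.inr hyh) hy.1.le) (not_le.2 huv)
    · obtain ⟨k, hk⟩ : Even K := hK' ▸ hodd.add_one
      have := tiltedMean_pow_sq_mul_le (k := k) (by omega) hM100 (z := 2 * y) (by linarith [hy.1])
        (by linarith)
      rw [show K = 2 * k by omega]
      push_cast
      rwa [show (M : ℝ) * y = M * (2 * y) / 2 by ring]

end extremal

lemma prodMean_le {ι : Type*} [Fintype ι] {p : ι → ℝ} (hp : ∀ i, p i ∈ Set.Icc (0 : ℝ) 1) :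
    prodMean p ≤ Real.sqrt (2 / Real.pi / (∑ i, p i + 1 / 4)) := by
  classical
  obtain ⟨N, hN⟩ := exists_nat_ge (2 * ∑ i, p i + 300)
  have h := prodMean_le_of_card (p := (Sum.elim p fun _ => 0 : ι ⊕ Fin N → ℝ)) ?_ ?_
  · simpa [prodMean] using h
  · rintro (i | i)
    · exact hp i
    · simp
  · simp only [Fintype.sum_sum_type, Sum.elim_inl, Sum.elim_inr, Finset.sum_const_zero, add_zero,
      Fintype.card_sum, Fintype.card_fin]
    push_cast
    linarith [(Fintype.card ι).cast_nonneg (α := ℝ)]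

section choose

/-- Summation by parts against a unimodal sequence of weights. -/
lemma sum_mul_sub_le_of_unimodal {c φ : ℕ → ℝ} {C : ℝ} {h : ℕ} (hc0 : 0 ≤ c 0)
    (hmono : ∀ i < h, c i ≤ c (i + 1)) (hanti : ∀ i, h ≤ i → c (i + 1) ≤ c i)
    (hφ : ∀ i, φ i ∈ Set.Icc 0 C) (n : ℕ) (hn : h ≤ n) :
    ∑ i ∈ Finset.range (n + 1), c i * (φ i - φ (i + 1)) ≤ C * c h - c n * φ (n + 1) := by
  have hup : ∀ n ≤ h, ∑ i ∈ Finset.range (n + 1), c i * (φ i - φ (i + 1)) ≤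
      C * c n - c n * φ (n + 1) := by
    intro n
    induction n with
    | zero =>
      intro _
      simp only [zero_add, Finset.sum_range_one]
      nlinarith [mul_le_mul_of_nonneg_left (hφ 0).2 hc0]
    | succ n ih =>
      intro hn
      rw [Finset.sum_range_succ]
      have := ih (by omega)
      have := mul_le_mul_of_nonneg_left (hφ (n + 1)).2 (sub_nonneg.2 (hmono n (by omega)))
      linarith
  induction n, hn using Nat.le_induction with
  | base => exact hup h le_rfl
  | succ n hn ih =>
    rw [Finset.sum_range_succ]
    have := mul_nonneg (sub_nonneg.2 (hanti n hn)) (hφ (n + 1)).1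
    linarith

lemma choose_succ_le_of_half_le {N i : ℕ} (h : N / 2 ≤ i) :
    N.choose (i + 1) ≤ N.choose i := by
  refine Nat.le_of_mul_le_mul_right (c := i + 1) ?_ (by omega)
  rw [Nat.choose_succ_right_eq]
  exact Nat.mul_le_mul_left _ (by omega)

lemma centralProb_eq (k : ℕ) : centralProb k = (Nat.centralBinom k : ℝ) / 4 ^ k := by
  induction k with
  | zero => simp [centralProb]
  | succ k ih =>
    rw [centralProb_succ, ih]
    have h : ((k : ℝ) + 1) * Nat.centralBinom (k + 1) = 2 * (2 * k + 1) * Nat.centralBinom k := by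
      exact_mod_cast Nat.succ_mul_centralBinom_succ k
    have h' : (Nat.centralBinom (k + 1) : ℝ) = 2 * (2 * k + 1) * Nat.centralBinom k / (k + 1) := by
      rw [eq_div_iff (by positivity)]
      linarith
    rw [h', pow_succ]
    field_simp
    ring

lemma choose_half_div_eq_betaMean (N : ℕ) :
    (N.choose (N / 2) : ℝ) / 2 ^ N = betaMean fun x => (1 - 2 * x) ^ N := by
  rcases Nat.even_or_odd' N with ⟨k, rfl | rfl⟩
  · rw [betaMean_one_sub_two_mul_pow_even, centralProb_eq, Nat.mul_div_cancel_left _ two_pos,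
      pow_mul, Nat.centralBinom_eq_two_mul_choose]
    norm_num
  · rw [betaMean_one_sub_two_mul_pow_odd, centralProb_eq, show (2 * k + 1) / 2 = k by omega,
      Nat.centralBinom_eq_two_mul_choose]
    have h : (2 * (k + 1)).choose (k + 1) = 2 * (2 * k + 1).choose k := by
      rw [show 2 * (k + 1) = 2 * k + 1 + 1 by ring, Nat.choose_succ_succ, Nat.choose_symm_half]
      ring
    rw [h, show (4 : ℝ) ^ (k + 1) = 2 ^ (2 * k + 1) * 2 by
      rw [pow_succ, pow_succ, pow_mul]; norm_num; ring]
    push_cast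
    field_simp

end choose

section operators

/-- The negated forward difference `φ k - φ (k + 1)`. -/
def stepDiff (φ : ℤ → ℝ) : ℤ → ℝ := fun k => φ k - φ (k + 1)

/-- The average of two neighbouring values. -/
noncomputable def stepAvg (φ : ℤ → ℝ) : ℤ → ℝ := fun k => (φ k + φ (k + 1)) / 2

/-- The correlation of a weight sequence with a function on the integers. -/
noncomputable def correl (a φ : ℤ → ℝ) : ℤ → ℝ := fun m => ∑' k, a k * φ (m + k)

lemma stepAvg_mem_Icc {φ : ℤ → ℝ} {b C : ℝ} (h : ∀ k, φ k ∈ Set.Icc b C) (k : ℤ) :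
    stepAvg φ k ∈ Set.Icc b C := by
  have h1 := h k
  have h2 := h (k + 1)
  constructor <;> simp only [stepAvg] <;> linarith [h1.1, h1.2, h2.1, h2.2]

lemma stepAvg_iterate_mem_Icc {φ : ℤ → ℝ} {b C : ℝ} (h : ∀ k, φ k ∈ Set.Icc b C) (N : ℕ) :
    ∀ k, stepAvg^[N] φ k ∈ Set.Icc b C := by
  induction N with
  | zero => exact h
  | succ N ih =>
    rw [Function.iterate_succ_apply']
    exact stepAvg_mem_Icc ih

lemma stepDiff_stepAvg (φ : ℤ → ℝ) : stepAvg (stepDiff φ) = stepDiff (stepAvg φ) := by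
  funext k
  simp only [stepAvg, stepDiff]
  ring

lemma stepDiff_mem_Icc {φ : ℤ → ℝ} {C : ℝ} (h : ∀ k, φ k ∈ Set.Icc 0 C) (k : ℤ) :
    stepDiff φ k ∈ Set.Icc (-C) C := by
  have h1 := h k
  have h2 := h (k + 1)
  constructor <;> simp only [stepDiff] <;> linarith [h1.1, h1.2, h2.1, h2.2]

lemma stepAvg_iterate_eq (φ : ℤ → ℝ) (N : ℕ) (k : ℤ) : stepAvg^[N] φ k =
    (∑ i ∈ Finset.range (N + 1), (N.choose i : ℝ) * φ (k + i)) / 2 ^ N := by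
  induction N generalizing k with
  | zero => simp
  | succ N ih =>
    rw [Function.iterate_succ_apply', stepAvg, ih, ih]
    have h : ∑ i ∈ Finset.range (N + 1 + 1), ((N + 1).choose i : ℝ) * φ (k + i) =
        ∑ i ∈ Finset.range (N + 1), (N.choose i : ℝ) * φ (k + i) +
        ∑ i ∈ Finset.range (N + 1), (N.choose i : ℝ) * φ (k + 1 + i) := by
      rw [Finset.sum_range_succ']
      simp only [Nat.choose_succ_succ, Nat.choose_zero_right, Nat.cast_add, add_mul,
        Finset.sum_add_distrib]
      rw [Finset.sum_range_succ (fun i => ((N.choose (i + 1) : ℕ) : ℝ) * φ _),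
        Finset.sum_range_succ' (fun i => (N.choose i : ℝ) * φ (k + i))]
      simp only [Nat.choose_succ_self, Nat.cast_zero, zero_mul, add_zero, Nat.choose_zero_right]
      have e : ∀ i : ℕ, k + ((i + 1 : ℕ) : ℤ) = k + 1 + i := fun i => by push_cast; ring
      push_cast at e ⊢
      simp only [e]
      ring
    rw [h, pow_succ]
    field_simp

lemma stepDiff_stepAvg_iterate_le {φ : ℤ → ℝ} {C : ℝ} (h : ∀ k, φ k ∈ Set.Icc 0 C) (N : ℕ)
    (k : ℤ) :
    stepDiff (stepAvg^[N] φ) k ≤ C * betaMean fun x => (1 - 2 * x) ^ N := by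
  have hsum := sum_mul_sub_le_of_unimodal (c := fun i => (N.choose i : ℝ))
    (φ := fun i : ℕ => φ (k + i)) (C := C) (h := N / 2) (by positivity)
    (fun i hi => by exact_mod_cast Nat.choose_le_succ_of_lt_half_left hi)
    (fun i hi => by exact_mod_cast choose_succ_le_of_half_le hi)
    (fun i => h _) N (Nat.div_le_self _ _)
  have hlast : 0 ≤ (N.choose N : ℝ) * φ (k + ((N + 1 : ℕ) : ℤ)) :=
    mul_nonneg (by positivity) (h _).1
  rw [← choose_half_div_eq_betaMean, ← mul_div_assoc, stepDiff, stepAvg_iterate_eq,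
    stepAvg_iterate_eq, ← sub_div, ← Finset.sum_sub_distrib]
  refine div_le_div_of_nonneg_right (le_trans (le_of_eq ?_) (hsum.trans (sub_le_self _ hlast)))
    (by positivity)
  refine Finset.sum_congr rfl fun i _ => ?_
  rw [mul_sub]
  push_cast
  rw [show k + 1 + (i : ℤ) = k + (i + 1) by ring]

variable {a φ : ℤ → ℝ}

lemma summable_mul_of_bounded (ha : Summable a) (ha0 : ∀ k, 0 ≤ a k) {b C : ℝ}
    (hφ : ∀ k, φ k ∈ Set.Icc b C) (f : ℤ → ℤ) : Summable fun k => a k * φ (f k) := by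
  refine Summable.of_norm_bounded (ha.mul_right (max |b| |C|)) fun k => ?_
  rw [norm_mul, Real.norm_of_nonneg (ha0 k)]
  exact mul_le_mul_of_nonneg_left (abs_le_max_abs_abs (hφ _).1 (hφ _).2) (ha0 k)

lemma correl_mem_Icc (ha : Summable a) (ha0 : ∀ k, 0 ≤ a k) {C : ℝ}
    (hφ : ∀ k, φ k ∈ Set.Icc 0 C) (m : ℤ) : correl a φ m ∈ Set.Icc 0 ((∑' k, a k) * C) := by
  constructor
  · exact tsum_nonneg fun k => mul_nonneg (ha0 k) (hφ _).1
  · rw [← tsum_mul_right]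
    exact (summable_mul_of_bounded ha ha0 hφ _).tsum_le_tsum
      (fun k => mul_le_mul_of_nonneg_left (hφ _).2 (ha0 k)) (ha.mul_right C)

lemma correl_stepDiff (ha : Summable a) (ha0 : ∀ k, 0 ≤ a k) {b C : ℝ}
    (hφ : ∀ k, φ k ∈ Set.Icc b C) : correl a (stepDiff φ) = stepDiff (correl a φ) := by
  funext m
  simp only [correl, stepDiff]
  rw [← (summable_mul_of_bounded ha ha0 hφ _).tsum_sub (summable_mul_of_bounded ha ha0 hφ _)]
  refine tsum_congr fun k => ?_
  rw [show m + 1 + k = m + k + 1 by ring]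
  ring

lemma correl_stepAvg (ha : Summable a) (ha0 : ∀ k, 0 ≤ a k) {b C : ℝ}
    (hφ : ∀ k, φ k ∈ Set.Icc b C) : correl a (stepAvg φ) = stepAvg (correl a φ) := by
  funext m
  simp only [correl, stepAvg]
  rw [← (summable_mul_of_bounded ha ha0 hφ _).tsum_add (summable_mul_of_bounded ha ha0 hφ _),
    ← tsum_div_const]
  refine tsum_congr fun k => ?_
  rw [show m + 1 + k = m + k + 1 by ring]
  ring

lemma correl_stepDiff_iterate (ha : Summable a) (ha0 : ∀ k, 0 ≤ a k) {b C : ℝ}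
    (hφ : ∀ k, φ k ∈ Set.Icc b C) (N : ℕ) :
    correl a (stepDiff (stepAvg^[N] φ)) = stepDiff (stepAvg^[N] (correl a φ)) := by
  rw [correl_stepDiff ha ha0 (stepAvg_iterate_mem_Icc hφ N)]
  congr 1
  induction N with
  | zero => rfl
  | succ N ih =>
    rw [Function.iterate_succ_apply', Function.iterate_succ_apply',
      correl_stepAvg ha ha0 (stepAvg_iterate_mem_Icc hφ N), ih]

end operators

section overlap

/-- The overlap of a weight sequence with its shift by one. -/
noncomputable def overlap (μ : ℤ → ℝ) : ℤ → ℝ := fun k => min (μ k) (μ (k + 1))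

/-- What is left of a weight sequence after removing half of the overlap at each of two
neighbouring points. -/
noncomputable def residue (μ : ℤ → ℝ) : ℤ → ℝ :=
  fun k => μ k - (overlap μ k + overlap μ (k - 1)) / 2

variable {μ : ℤ → ℝ}

lemma overlap_nonneg (h0 : ∀ k, 0 ≤ μ k) (k : ℤ) : 0 ≤ overlap μ k := le_min (h0 _) (h0 _)

lemma residue_nonneg (k : ℤ) : 0 ≤ residue μ k := by
  have h1 : overlap μ k ≤ μ k := min_le_left _ _
  have h2 : overlap μ (k - 1) ≤ μ k := by
    simp [overlap]
  simp only [residue]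
  linarith

lemma summable_overlap (hμ : Summable μ) (h0 : ∀ k, 0 ≤ μ k) : Summable (overlap μ) :=
  Summable.of_nonneg_of_le (overlap_nonneg h0) (fun _ => min_le_left _ _) hμ

lemma summable_sub_one {f : ℤ → ℝ} (hf : Summable f) : Summable fun k => f (k - 1) :=
  (Equiv.subRight (1 : ℤ)).summable_iff.2 hf

lemma tsum_sub_one (f : ℤ → ℝ) : ∑' k, f (k - 1) = ∑' k, f k :=
  (Equiv.subRight (1 : ℤ)).tsum_eq f

lemma summable_residue (hμ : Summable μ) (h0 : ∀ k, 0 ≤ μ k) : Summable (residue μ) :=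
  hμ.sub (((summable_overlap hμ h0).add (summable_sub_one (summable_overlap hμ h0))).div_const 2)

lemma tsum_residue (hμ : Summable μ) (h0 : ∀ k, 0 ≤ μ k) :
    ∑' k, residue μ k = ∑' k, μ k - ∑' k, overlap μ k := by
  have ho := summable_overlap hμ h0
  unfold residue
  rw [hμ.tsum_sub ((ho.add (summable_sub_one ho)).div_const 2), tsum_div_const,
    ho.tsum_add (summable_sub_one ho), tsum_sub_one]
  ring

lemma tsum_overlap_mem_Icc (hμ : Summable μ) (h0 : ∀ k, 0 ≤ μ k) (h1 : ∑' k, μ k = 1) :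
    ∑' k, overlap μ k ∈ Set.Icc (0 : ℝ) 1 :=
  ⟨tsum_nonneg (overlap_nonneg h0),
    h1 ▸ (summable_overlap hμ h0).tsum_le_tsum (fun _ => min_le_left _ _) hμ⟩

/-- Splitting off uniform laws on pairs of neighbouring integers. -/
lemma correl_eq_residue_add (hμ : Summable μ) (h0 : ∀ k, 0 ≤ μ k) {φ : ℤ → ℝ} {b C : ℝ}
    (hφ : ∀ k, φ k ∈ Set.Icc b C) (m : ℤ) :
    correl μ φ m = correl (residue μ) φ m + correl (overlap μ) (stepAvg φ) m := by
  have ho := summable_overlap hμ h0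
  have ho0 := overlap_nonneg h0
  have e : ∑' k, overlap μ k * φ (m + k + 1) = ∑' k, overlap μ (k - 1) * φ (m + k) := by
    rw [← tsum_sub_one]
    refine tsum_congr fun k => ?_
    congr 2
    ring
  have h1 : correl (overlap μ) (stepAvg φ) m = (∑' k, overlap μ k * φ (m + k) +
      ∑' k, overlap μ (k - 1) * φ (m + k)) / 2 := by
    rw [← e, ← (summable_mul_of_bounded ho ho0 hφ _).tsum_add
      (summable_mul_of_bounded ho ho0 hφ _), ← tsum_div_const]
    refine tsum_congr fun k => ?_
    simp only [stepAvg]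
    ring
  have s1 := summable_mul_of_bounded ho ho0 hφ (fun k => m + k)
  have s2 := summable_mul_of_bounded (summable_sub_one ho) (fun k => ho0 (k - 1)) hφ
    (fun k => m + k)
  have s3 := summable_mul_of_bounded hμ h0 hφ (fun k => m + k)
  have h2 : correl (residue μ) φ m = ∑' k, μ k * φ (m + k) - (∑' k, overlap μ k * φ (m + k) +
      ∑' k, overlap μ (k - 1) * φ (m + k)) / 2 := by
    rw [← s1.tsum_add s2, ← tsum_div_const, ← s3.tsum_sub ((s1.add s2).div_const 2)]
    refine tsum_congr fun k => ?_
    simp only [residue]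
    ring
  rw [h1, h2]
  simp only [correl]
  ring

lemma correl_stepDiff_iterate_eq (hμ : Summable μ) (h0 : ∀ k, 0 ≤ μ k) {φ : ℤ → ℝ} {C : ℝ}
    (hφ : ∀ k, φ k ∈ Set.Icc 0 C) (N : ℕ) (m : ℤ) :
    correl μ (stepDiff (stepAvg^[N] φ)) m =
      stepDiff (stepAvg^[N] (correl (residue μ) φ)) m +
      stepDiff (stepAvg^[N + 1] (correl (overlap μ) φ)) m := by
  rw [correl_eq_residue_add hμ h0 (stepDiff_mem_Icc (stepAvg_iterate_mem_Icc hφ N)),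
    correl_stepDiff_iterate (summable_residue hμ h0) residue_nonneg hφ, stepDiff_stepAvg,
    ← Function.iterate_succ_apply' stepAvg,
    correl_stepDiff_iterate (summable_overlap hμ h0) (overlap_nonneg h0) hφ]

end overlap

section law

variable {Ω : Type*} [MeasurableSpace Ω] {P : Measure Ω}

/-- The probability mass function of an integer-valued random variable. -/
noncomputable def lawAt (P : Measure Ω) (X : Ω → ℤ) (k : ℤ) : ℝ := (P.map X).real {k}

lemma lawAt_nonneg (X : Ω → ℤ) (k : ℤ) : 0 ≤ lawAt P X k := measureReal_nonneg

variable [IsProbabilityMeasure P]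

lemma integrable_of_bounded {Z : Type*} [MeasurableSpace Z] {ν : Measure Z} [IsFiniteMeasure ν]
    {f : Z → ℝ} (hf : Measurable f) {b C : ℝ} (h : ∀ z, f z ∈ Set.Icc b C) : Integrable f ν :=
  Integrable.of_bound hf.aestronglyMeasurable (max |b| |C|)
    (Filter.Eventually.of_forall fun z => abs_le_max_abs_abs (h z).1 (h z).2)

lemma integrable_comp_of_bounded {Y : Ω → ℤ} (hY : Measurable Y) {f : ℤ → ℝ} {b C : ℝ}
    (h : ∀ k, f k ∈ Set.Icc b C) : Integrable (fun ω => f (Y ω)) P :=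
  integrable_of_bounded ((measurable_of_countable f).comp hY) fun _ => h _

lemma tsum_lawAt {X : Ω → ℤ} (hX : Measurable X) : ∑' k, lawAt P X k = 1 := by
  have := Measure.isProbabilityMeasure_map (μ := P) hX.aemeasurable
  have h := integral_countable (μ := P.map X) (f := fun _ : ℤ => (1 : ℝ)) (integrable_const 1)
  simpa [lawAt] using h.symm

lemma summable_lawAt {X : Ω → ℤ} (hX : Measurable X) : Summable (lawAt P X) := by
  by_contra h
  have := tsum_lawAt (P := P) hX
  rw [tsum_eq_zero_of_not_summable h] at this
  exact zero_ne_one this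

lemma integral_map_add_eq_correl {X : Ω → ℤ} (hX : Measurable X) {f : ℤ → ℝ} {b C : ℝ}
    (hf : ∀ k, f k ∈ Set.Icc b C) (m : ℤ) :
    ∫ x, f (m + x) ∂(P.map X) = correl (lawAt P X) f m := by
  have := Measure.isProbabilityMeasure_map (μ := P) hX.aemeasurable
  rw [integral_countable (integrable_of_bounded (measurable_of_countable _) fun _ => hf _)]
  rfl

lemma integral_add_eq_correl {X : Ω → ℤ} (hX : Measurable X) {f : ℤ → ℝ} {b C : ℝ}
    (hf : ∀ k, f k ∈ Set.Icc b C) (m : ℤ) :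
    ∫ ω, f (m + X ω) ∂P = correl (lawAt P X) f m := by
  rw [← integral_map_add_eq_correl hX hf,
    integral_map hX.aemeasurable (measurable_of_countable _).aestronglyMeasurable]

lemma integral_add_of_indepFun {X Y : Ω → ℤ} (hX : Measurable X) (hY : Measurable Y)
    (h : IndepFun Y X P) {f : ℤ → ℝ} {b C : ℝ} (hf : ∀ k, f k ∈ Set.Icc b C) (m : ℤ) :
    ∫ ω, f (m + (X ω + Y ω)) ∂P = ∫ ω, correl (lawAt P X) f (m + Y ω) ∂P := by
  have := Measure.isProbabilityMeasure_map (μ := P) hX.aemeasurable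
  have := Measure.isProbabilityMeasure_map (μ := P) hY.aemeasurable
  have h1 : ∫ ω, f (m + (X ω + Y ω)) ∂P =
      ∫ z, f (m + (z.2 + z.1)) ∂(P.map fun ω => (Y ω, X ω)) := by
    rw [integral_map (by fun_prop) (measurable_of_countable _).aestronglyMeasurable]
  rw [h1, h.map_prod_eq_prod_map_map hY.aemeasurable hX.aemeasurable,
    integral_prod _ (integrable_of_bounded (measurable_of_countable _) fun _ => hf _),
    integral_map hY.aemeasurable (measurable_of_countable _).aestronglyMeasurable]
  refine integral_congr_ae (Filter.Eventually.of_forall fun ω => ?_)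
  simp only
  rw [← integral_map_add_eq_correl hX hf]
  refine integral_congr_ae (Filter.Eventually.of_forall fun x => ?_)
  simp only
  congr 1
  ring

/-- The total overlap of the law of `X` with the law of `1 + X`. -/
noncomputable def overlapMass (P : Measure Ω) (X : Ω → ℤ) : ℝ := ∑' k, overlap (lawAt P X) k

lemma overlapMass_mem_Icc {X : Ω → ℤ} (hX : Measurable X) :
    overlapMass P X ∈ Set.Icc (0 : ℝ) 1 :=
  tsum_overlap_mem_Icc (summable_lawAt hX) (lawAt_nonneg X) (tsum_lawAt hX)

/-- Smoothing estimate for a sum of independent integer-valued random variables. -/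
lemma integral_stepDiff_iterate_le {ι : Type*} [DecidableEq ι] {X : ι → Ω → ℤ}
    (hX : ∀ j, Measurable (X j)) (hindep : iIndepFun X P) (s : Finset ι) (N : ℕ) {φ : ℤ → ℝ}
    {C : ℝ} (hφ : ∀ k, φ k ∈ Set.Icc 0 C) (m : ℤ) :
    ∫ ω, stepDiff (stepAvg^[N] φ) (m + ∑ j ∈ s, X j ω) ∂P ≤
      C * betaMean fun x => (1 - 2 * x) ^ N * ∏ j ∈ s, (1 - 2 * overlapMass P (X j) * x) := by
  induction s using Finset.induction_on generalizing N φ C with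
  | empty => simpa using stepDiff_stepAvg_iterate_le hφ N m
  | insert i s hi ih =>
    have hμ := summable_lawAt (P := P) (hX i)
    have h0 := lawAt_nonneg (P := P) (X i)
    have hY : Measurable fun ω => ∑ j ∈ s, X j ω := Finset.measurable_fun_sum s fun j _ => hX j
    have hind : IndepFun (fun ω => ∑ j ∈ s, X j ω) (X i) P := by
      have := hindep.indepFun_finsetSum_of_notMem hX hi
      convert this using 1
      funext ω
      simp
    have hbd := fun {ψ : ℤ → ℝ} {B : ℝ} (h : ∀ k, ψ k ∈ Set.Icc 0 B) (N : ℕ) =>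
      stepDiff_mem_Icc (stepAvg_iterate_mem_Icc h N)
    have hr := correl_mem_Icc (summable_residue hμ h0) residue_nonneg hφ
    have ho := correl_mem_Icc (summable_overlap hμ h0) (overlap_nonneg h0) hφ
    simp only [Finset.sum_insert hi, Finset.prod_insert hi]
    rw [integral_add_of_indepFun (hX i) hY hind (hbd hφ N)]
    simp only [correl_stepDiff_iterate_eq hμ h0 hφ]
    rw [integral_add
      (integrable_comp_of_bounded (hY.const_add m) (hbd hr N))
      (integrable_comp_of_bounded (hY.const_add m) (hbd ho (N + 1)))]
    refine (add_le_add (ih N hr) (ih (N + 1) ho)).trans_eq ?_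
    rw [tsum_residue hμ h0, tsum_lawAt (hX i), ← betaMean_const_mul, ← betaMean_const_mul,
      ← betaMean_const_mul, ← betaMean_add (by fun_prop) (by fun_prop)]
    congr 1
    funext x
    simp only [overlapMass]
    ring

lemma bddAbove_dTV (Z₁ Z₂ : Ω → ℤ) : BddAbove (Set.range fun A : Set ℤ =>
    |P.real {ω | Z₁ ω ∈ A} - P.real {ω | Z₂ ω ∈ A}|) := by
  refine ⟨1, ?_⟩
  rintro _ ⟨A, rfl⟩
  have h1 := measureReal_le_one (μ := P) (s := {ω | Z₁ ω ∈ A})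
  have h2 := measureReal_le_one (μ := P) (s := {ω | Z₂ ω ∈ A})
  have h3 := measureReal_nonneg (μ := P) (s := {ω | Z₁ ω ∈ A})
  have h4 := measureReal_nonneg (μ := P) (s := {ω | Z₂ ω ∈ A})
  exact abs_le.2 ⟨by linarith, by linarith⟩

lemma dTV_le_one (Z₁ Z₂ : Ω → ℤ) : dTV P Z₁ Z₂ ≤ 1 := by
  refine ciSup_le fun A => ?_
  have h1 := measureReal_le_one (μ := P) (s := {ω | Z₁ ω ∈ A})
  have h2 := measureReal_le_one (μ := P) (s := {ω | Z₂ ω ∈ A})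
  have h3 := measureReal_nonneg (μ := P) (s := {ω | Z₁ ω ∈ A})
  have h4 := measureReal_nonneg (μ := P) (s := {ω | Z₂ ω ∈ A})
  exact abs_le.2 ⟨by linarith, by linarith⟩

lemma indicator_one_mem_Icc (A : Set ℤ) (k : ℤ) :
    A.indicator (fun _ => (1 : ℝ)) k ∈ Set.Icc 0 1 := by
  by_cases h : k ∈ A <;> simp [h]

lemma integral_stepDiff_indicator {Z : Ω → ℤ} (hZ : Measurable Z) (A : Set ℤ) :
    ∫ ω, stepDiff (A.indicator fun _ => (1 : ℝ)) (0 + Z ω) ∂P =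
      P.real {ω | Z ω ∈ A} - P.real {ω | 1 + Z ω ∈ A} := by
  have h : ∀ Y : Ω → ℤ, Measurable Y →
      ∫ ω, A.indicator (fun _ => (1 : ℝ)) (Y ω) ∂P = P.real {ω | Y ω ∈ A} := by
    intro Y hY
    have hA : MeasurableSet {ω | Y ω ∈ A} := hY (MeasurableSet.of_discrete (s := A))
    rw [← integral_indicator_one hA]
    rfl
  have hZ1 : Measurable fun ω => 1 + Z ω := hZ.const_add 1
  rw [← h Z hZ, ← h _ hZ1, ← integral_sub]
  · refine integral_congr_ae (Filter.Eventually.of_forall fun ω => ?_)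
    simp only [stepDiff, zero_add, add_comm (1 : ℤ) (Z ω)]
  · exact integrable_comp_of_bounded hZ (indicator_one_mem_Icc A)
  · exact integrable_comp_of_bounded hZ1 (indicator_one_mem_Icc A)

lemma dTV_sum_le_prodMean {ι : Type*} [Fintype ι] {X : ι → Ω → ℤ} (hX : ∀ j, Measurable (X j))
    (hindep : iIndepFun X P) :
    dTV P (fun ω => ∑ j, X j ω) (fun ω => 1 + ∑ j, X j ω) ≤
      prodMean fun j => overlapMass P (X j) := by
  classical
  have hS : Measurable fun ω => ∑ j, X j ω := Finset.measurable_fun_sum _ fun j _ => hX j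
  have key : ∀ A : Set ℤ, P.real {ω | ∑ j, X j ω ∈ A} - P.real {ω | 1 + ∑ j, X j ω ∈ A} ≤
      prodMean fun j => overlapMass P (X j) := by
    intro A
    rw [← integral_stepDiff_indicator hS]
    have := integral_stepDiff_iterate_le hX hindep Finset.univ 0 (indicator_one_mem_Icc A) 0
    simpa [prodMean] using this
  refine ciSup_le fun A => abs_le.2 ⟨?_, key A⟩
  have hc : ∀ Y : Ω → ℤ, Measurable Y →
      P.real {ω | Y ω ∈ Aᶜ} = 1 - P.real {ω | Y ω ∈ A} := by
    intro Y hY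
    have hA : MeasurableSet {ω | Y ω ∈ A} := hY (MeasurableSet.of_discrete (s := A))
    rw [← probReal_compl_eq_one_sub hA]
    rfl
  have h1 := key Aᶜ
  rw [hc _ hS, hc _ (hS.const_add 1)] at h1
  linarith

lemma one_sub_dTV_le_overlapMass {X : Ω → ℤ} (hX : Measurable X) :
    1 - dTV P X (fun ω => 1 + X ω) ≤ overlapMass P X := by
  set μ := lawAt P X with hμdef
  have hμ : Summable μ := summable_lawAt hX
  have h0 : ∀ k, 0 ≤ μ k := lawAt_nonneg X
  set A : Set ℤ := {k | μ (k - 1) < μ k}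
  have h1 : |P.real {ω | X ω ∈ A} - P.real {ω | 1 + X ω ∈ A}| ≤ dTV P X (fun ω => 1 + X ω) :=
    le_ciSup (bddAbove_dTV X fun ω => 1 + X ω) A
  have h2 : P.real {ω | X ω ∈ A} - P.real {ω | 1 + X ω ∈ A} = 1 - overlapMass P X := by
    have hI := indicator_one_mem_Icc A
    rw [← integral_stepDiff_indicator hX,
      integral_add_eq_correl hX (stepDiff_mem_Icc hI), ← hμdef]
    have s1 := summable_mul_of_bounded hμ h0 hI (fun k => k)
    have s2 := summable_mul_of_bounded hμ h0 hI (fun k => k + 1)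
    have s3 := summable_mul_of_bounded (summable_sub_one hμ) (fun k => h0 (k - 1)) hI (fun k => k)
    have e1 : correl μ (stepDiff (A.indicator fun _ => (1 : ℝ))) 0 =
        ∑' k, μ k * A.indicator (fun _ => (1 : ℝ)) k -
        ∑' k, μ (k - 1) * A.indicator (fun _ => (1 : ℝ)) k := by
      have e2 : ∑' k, μ (k - 1) * A.indicator (fun _ => (1 : ℝ)) k =
          ∑' k, μ k * A.indicator (fun _ => (1 : ℝ)) (k + 1) := by
        rw [← tsum_sub_one fun k => μ k * A.indicator (fun _ => (1 : ℝ)) (k + 1)]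
        simp
      rw [e2, ← s1.tsum_sub s2]
      refine tsum_congr fun k => ?_
      simp only [stepDiff, zero_add]
      ring
    have ho := summable_sub_one (summable_overlap hμ h0)
    have e3 : 1 - overlapMass P X = ∑' k, (μ k - overlap μ (k - 1)) := by
      rw [hμ.tsum_sub ho, tsum_sub_one, tsum_lawAt hX, overlapMass]
    rw [e1, ← s1.tsum_sub s3, e3]
    refine tsum_congr fun k => ?_
    simp only [overlap, sub_add_cancel]
    by_cases hk : μ (k - 1) < μ k
    · rw [Set.indicator_of_mem (show k ∈ A from hk), min_eq_left hk.le]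
      ring
    · rw [Set.indicator_of_notMem (show k ∉ A from hk), min_eq_right (not_lt.1 hk)]
      ring
  have := le_abs_self (P.real {ω | X ω ∈ A} - P.real {ω | 1 + X ω ∈ A})
  linarith

end law

lemma rpow_neg_half_eq (y : ℝ) (hy : 0 ≤ y) : y ^ (-(1 / 2) : ℝ) = (Real.sqrt y)⁻¹ := by
  rw [Real.rpow_neg hy, Real.sqrt_eq_rpow]

/-- The smoothness bound for sums of independent integer-valued random variables, together with
the comparison showing that it improves the earlier bound
`(∑ j, (1 - max (1 / 2) (dTV (X j) (1 + X j)))) ^ (-1 / 2)`, which is read as `+∞` when the sum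
vanishes. -/
theorem corollary1p6 {Ω : Type*} [MeasurableSpace Ω] (P : Measure Ω) [IsProbabilityMeasure P]
    (n : ℕ) (X : Fin n → Ω → ℤ) (hX : ∀ j, Measurable (X j)) (hindep : iIndepFun X P) :
    dTV P (fun ω => ∑ j, X j ω) (fun ω => 1 + ∑ j, X j ω) ≤
      Real.sqrt (2 / Real.pi) *
        (1 / 4 + ∑ j, (1 - dTV P (X j) (fun ω => 1 + X j ω))) ^ (-(1 / 2) : ℝ) ∧
    (0 < ∑ j, (1 - max (1 / 2) (dTV P (X j) (fun ω => 1 + X j ω))) →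
      Real.sqrt (2 / Real.pi) *
          (1 / 4 + ∑ j, (1 - dTV P (X j) (fun ω => 1 + X j ω))) ^ (-(1 / 2) : ℝ) <
        (∑ j, (1 - max (1 / 2) (dTV P (X j) (fun ω => 1 + X j ω)))) ^ (-(1 / 2) : ℝ)) := by
  have hd : ∀ j, dTV P (X j) (fun ω => 1 + X j ω) ≤ 1 := fun j => dTV_le_one _ _
  have hsum0 : 0 ≤ ∑ j, (1 - dTV P (X j) (fun ω => 1 + X j ω)) :=
    Finset.sum_nonneg fun j _ => sub_nonneg.2 (hd j)
  constructor
  · rw [rpow_neg_half_eq _ (by linarith), ← div_eq_mul_inv, ← Real.sqrt_div (by positivity)]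
    refine (dTV_sum_le_prodMean hX hindep).trans
      ((prodMean_le fun j => overlapMass_mem_Icc (hX j)).trans (Real.sqrt_le_sqrt ?_))
    have hle : ∑ j, (1 - dTV P (X j) (fun ω => 1 + X j ω)) ≤ ∑ j, overlapMass P (X j) :=
      Finset.sum_le_sum fun j _ => one_sub_dTV_le_overlapMass (hX j)
    exact div_le_div_of_nonneg_left (by positivity) (by linarith) (by linarith)
  · intro hpos
    have hle : ∑ j, (1 - max (1 / 2) (dTV P (X j) (fun ω => 1 + X j ω))) ≤
        ∑ j, (1 - dTV P (X j) (fun ω => 1 + X j ω)) :=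
      Finset.sum_le_sum fun j _ => sub_le_sub_left (le_max_right _ _) _
    have hlt : (1 / 4 + ∑ j, (1 - dTV P (X j) (fun ω => 1 + X j ω))) ^ (-(1 / 2) : ℝ) <
        (∑ j, (1 - max (1 / 2) (dTV P (X j) (fun ω => 1 + X j ω)))) ^ (-(1 / 2) : ℝ) :=
      Real.rpow_lt_rpow_of_neg hpos (by linarith) (by norm_num)
    have hsqrt : Real.sqrt (2 / Real.pi) ≤ 1 := by
      rw [Real.sqrt_le_one, div_le_one Real.pi_pos]
      exact Real.two_le_pi
    exact (mul_le_of_le_one_left (Real.rpow_nonneg (by linarith) _) hsqrt).trans_lt hlt
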